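/- **The problem.** Let $n, m\in\mathbb N$ and $\rho\in(0,1/2)$. In the Perturbed Distributional Boolean Hidden Partition problem (PD-BHP), Alice receives a uniformly random $x\in\{0,1\}^n$. Bob receives a random simple graph $G$ on $n$ vertices, independent of $x$, which is the union of $m$ independent uniformly random unordered pairs of distinct vertices (repetitions allowed; this distribution is denoted $\mathcal G_{n,m}$), together with a vector $w\in\{0,1\}^{E(G)}$. Let $M\in\{0,1\}^{E(G)\times n}$ be the edge-vertex incidence matrix of $G$. With probability $1/2$ each, the instance is - a YES instance: $w=Mx+\Delta \pmod 2$, where the entries of $\Delta$ are independent of each other and of $(x,G)$, and each is $1$ with probability $1/2+\rho$ and $0$ otherwise; or - a NO instance: $w$ is uniformly random in $\{0,1\}^{E(G)}$, independent of $x$. In a deterministic one-way protocol, Alice sends Bob a bit string that depends only on $x$, and Bob answers YES or NO as a function of this string, $G$ and $w$. The protocol uses at most $c$ bits if Alice's message never has more than $c$ bits. Its advantage over random guessing is the probability that Bob's answer is correct, minus $1/2$. **Lemma.** There is an absolute constant $C>0$ such that the following holds. Let $\varepsilon=\varepsilon(n)$, $\gamma=\gamma(n)$, $\alpha=\alpha(n)$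 be real parameters such that, for all sufficiently large $n$, $$0<\varepsilon<0.05,\qquad \gamma>0,\qquad \frac{\varepsilon^2}{n}\le\alpha\le\min\left(10^{-7}\gamma^{-2},\,10^{-4}\right),$$ and such that $\varepsilon=\omega\left(\frac1{\sqrt n}\right)$ and $\gamma=\omega\left(\frac{\log n}{\sqrt n}\right)$ as $n\to\infty$. Then, for all sufficiently large $n$, every deterministic one-way protocol for PD-BHP with $m=\lfloor \alpha n/\varepsilon^2\rfloor$ and $\rho=10\varepsilon$ that uses at most $\gamma\sqrt n$ bits of communication has advantage over random guessing at most $C\,(\gamma+\alpha)\sqrt\alpha$. -/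

import Mathlib

open Filter Asymptotics
open scoped BigOperators

namespace PDBHP

/-- The unordered pairs of distinct vertices of the vertex set `Fin n`. -/
abbrev VertexPair (n : ℕ) : Type := {e : Sym2 (Fin n) // ¬ e.IsDiag}

/-- The simple graph that is the union of the sampled pairs `s 0, …, s (m - 1)` (repetitions are
allowed in the sample, and collapse in the graph). For a uniformly random `s`, this is the
random graph `𝒢_{n,m}`. -/
def unionGraph {n m : ℕ} (s : Fin m → VertexPair n) : SimpleGraph (Fin n) :=
  SimpleGraph.fromEdgeSet (Set.range fun i => (s i : Sym2 (Fin n)))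

open scoped Classical in
/-- The edge-vertex incidence matrix of `G` over the field with two elements: one row for each
edge, one column for each vertex. -/
noncomputable def edgeVertexMatrix {n : ℕ} (G : SimpleGraph (Fin n)) :
    Matrix G.edgeSet (Fin n) (ZMod 2) :=
  Matrix.of fun e v => G.incMatrix (ZMod 2) v e

/-- The probability of the noise vector `Δ`, when its entries are independent and each of them is
`1` with probability `1 / 2 + ρ` and `0` with probability `1 / 2 - ρ`. -/
noncomputable def noiseProb {E : Type*} [Fintype E] (ρ : ℝ) (Δ : E → ZMod 2) : ℝ :=
  ∏ e, if Δ e = 1 then 1 / 2 + ρ else 1 / 2 - ρ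

/-- A deterministic one-way protocol on `n` vertices: Alice maps her vector to a bit string, and
Bob maps this string, his graph and his vector of edge labels to an answer (`true` is YES and
`false` is NO). -/
structure Protocol (n : ℕ) where
  message : (Fin n → ZMod 2) → List Bool
  answer : List Bool → (G : SimpleGraph (Fin n)) → (G.edgeSet → ZMod 2) → Bool

namespace Protocol

variable {n : ℕ}

/-- The protocol never communicates more than `c` bits. -/
def UsesAtMost (P : Protocol n) (c : ℝ) : Prop :=
  ∀ x, ((P.message x).length : ℝ) ≤ c

open scoped Classical in
/-- The probability that the answer is YES in the YES case: `x` is uniform, the graph `G` is the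
union of `m` uniform pairs, and Bob's labels are `M x + Δ` with noise parameter `ρ`. -/
noncomputable def yesCorrectProb (P : Protocol n) (m : ℕ) (ρ : ℝ) : ℝ :=
  𝔼 x : Fin n → ZMod 2, 𝔼 s : Fin m → VertexPair n,
    ∑ Δ : (unionGraph s).edgeSet → ZMod 2,
      noiseProb ρ Δ *
        (if P.answer (P.message x) (unionGraph s)
            ((edgeVertexMatrix (unionGraph s)).mulVec x + Δ) = true then 1 else 0)

open scoped Classical in
/-- The probability that the answer is NO in the NO case: `x` is uniform, the graph `G` is the
union of `m` uniform pairs, and Bob's labels are uniform and independent of `x`. -/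
noncomputable def noCorrectProb (P : Protocol n) (m : ℕ) : ℝ :=
  𝔼 x : Fin n → ZMod 2, 𝔼 s : Fin m → VertexPair n,
    𝔼 w : (unionGraph s).edgeSet → ZMod 2,
      (if P.answer (P.message x) (unionGraph s) w = false then 1 else 0)

/-- The advantage over random guessing: the probability of a correct answer, when the YES case and
the NO case have probability `1 / 2` each, minus `1 / 2`. -/
noncomputable def advantage (P : Protocol n) (m : ℕ) (ρ : ℝ) : ℝ :=
  (1 / 2 * P.yesCorrectProb m ρ + 1 / 2 * P.noCorrectProb m) - 1 / 2

end Protocol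

end PDBHP

/-! Fix a message and let `A` be the set of inputs that produce it. For a fixed graph,
Cauchy–Schwarz bounds Bob's gain on `A` by the chi-square distance of his labels from uniform. That
distance is a sum over nonempty edge sets `S` of `(4ρ²)^|S|` times the square of the character sum
of `S` over `A`. All coefficients are nonnegative and a random graph contains `S` with probability
at most `(m/N)^|S|`, where `N` is the number of vertex pairs. Averaging over graphs therefore leaves
a product over all pairs, with a weight `q` of order `α/n` per pair (`sq_sum_sampleGap_le`).

Over the complete graph, the edge signs of `x` and `y` multiply and sum to `(corr x y ^ 2 - n) / 2`.
What remains is the average of `exp (q * corr² / 2)` over `A × A`. A Gaussian integral linearizes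
the square into `cosh (s * corr)`, which is the even part of a noise kernel. Hypercontractivity
controls this kernel on a set of density at least `exp (-L)`; evenness removes level one, so the
error is `(sL)²` rather than `sL`. Integration gives `(1 - nq)^(-1/2) + O(qL²)`
(`sum_exp_corr_sq_le`).

With `t = nq`, the factor `(1 - t)^(-1/2)` is cancelled through second order by the diagonal and
quadratic terms of the product (`sum_prod_vertexPair_le`). The surviving `t³`, of order `α³`, is the
scale of triangles, which help Bob even without a message. With `L` of order `γ√n`, the term `qL²`
is of order `αγ²`. The square root of the total is of order `(γ + α)√α`. Fibers of density below
`exp (-L)` are too few and too small to matter. -/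

namespace PDBHP

/-! ### Signs -/

/-- The nontrivial real character of `ZMod 2`. -/
def sgn (a : ZMod 2) : ℝ := if a = 1 then -1 else 1

lemma sum_zmod_two {M : Type*} [AddCommMonoid M] (f : ZMod 2 → M) : ∑ a, f a = f 0 + f 1 :=
  Fin.sum_univ_two f

lemma zmod_two_cases (a : ZMod 2) : a = 0 ∨ a = 1 := by
  revert a; decide

@[simp] lemma sgn_zero : sgn 0 = 1 := by simp [sgn]

@[simp] lemma sgn_one : sgn 1 = -1 := by simp [sgn]

lemma sgn_add (a b : ZMod 2) : sgn (a + b) = sgn a * sgn b := by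
  have h : (1 : ZMod 2) + 1 = 0 := by decide
  rcases zmod_two_cases a with rfl | rfl <;> rcases zmod_two_cases b with rfl | rfl <;> simp [h]

lemma sgn_mul_self (a : ZMod 2) : sgn a * sgn a = 1 := by
  rcases zmod_two_cases a with rfl | rfl <;> simp

/-! ### The two-point inequality -/

/-- Equality holds at `r = 0`. The derivative in `r` is nonnegative by AM–GM, since `(1 + r)^(s-1)`
and `(1 - r)^(s-1)` have product `(1 - r²)^(s-1) ≥ 1`. -/
lemma two_mul_le_rpow_sub_rpow {s r : ℝ} (hs0 : 0 ≤ s) (hs1 : s ≤ 1) (hr0 : 0 ≤ r) (hr1 : r ≤ 1) :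
    2 * s * r ≤ (1 + r) ^ s - (1 - r) ^ s := by
  rcases hs0.eq_or_lt with rfl | hs
  · simp
  have hmono : MonotoneOn (fun r : ℝ => (1 + r) ^ s - (1 - r) ^ s - 2 * s * r) (Set.Icc 0 1) := by
    have hcont : ContinuousOn (fun r : ℝ => (1 + r) ^ s - (1 - r) ^ s - 2 * s * r)
        (Set.Icc 0 1) := by
      refine ContinuousOn.sub (ContinuousOn.sub ?_ ?_) (by fun_prop)
      · exact ContinuousOn.rpow_const (by fun_prop) fun _ _ => Or.inr hs0
      · exact ContinuousOn.rpow_const (by fun_prop) fun _ _ => Or.inr hs0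
    have hder : ∀ x ∈ interior (Set.Icc (0 : ℝ) 1),
        HasDerivAt (fun r : ℝ => (1 + r) ^ s - (1 - r) ^ s - 2 * s * r)
          (s * ((1 + x) ^ (s - 1) + (1 - x) ^ (s - 1) - 2)) x := by
      intro x hx
      rw [interior_Icc] at hx
      have h1 : HasDerivAt (fun r : ℝ => (1 + r) ^ s) (1 * s * (1 + x) ^ (s - 1)) x :=
        ((hasDerivAt_id x).const_add 1).rpow_const (Or.inl (by simp; linarith [hx.1]))
      have h2 : HasDerivAt (fun r : ℝ => (1 - r) ^ s) (-1 * s * (1 - x) ^ (s - 1)) x :=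
        ((hasDerivAt_id x).const_sub 1).rpow_const (Or.inl (by simp; linarith [hx.2]))
      refine ((h1.sub h2).sub ((hasDerivAt_id x).const_mul (2 * s))).congr_deriv ?_
      ring
    refine monotoneOn_of_deriv_nonneg (convex_Icc 0 1) hcont
      (fun x hx => (hder x hx).differentiableAt.differentiableWithinAt) fun x hx => ?_
    rw [(hder x hx).deriv]
    rw [interior_Icc] at hx
    refine mul_nonneg hs0 ?_
    have ha : 0 < (1 + x) ^ (s - 1) := Real.rpow_pos_of_pos (by linarith [hx.1]) _
    have hb : 0 < (1 - x) ^ (s - 1) := Real.rpow_pos_of_pos (by linarith [hx.2]) _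
    have hab : 1 ≤ (1 + x) ^ (s - 1) * (1 - x) ^ (s - 1) := by
      rw [← Real.mul_rpow (by linarith [hx.1]) (by linarith [hx.2])]
      exact Real.one_le_rpow_of_pos_of_le_one_of_nonpos
        (mul_pos (by linarith [hx.1]) (by linarith [hx.2])) (by nlinarith [hx.1]) (by linarith)
    nlinarith [sq_nonneg ((1 + x) ^ (s - 1) - (1 - x) ^ (s - 1))]
  have := hmono (Set.left_mem_Icc.2 zero_le_one) ⟨hr0, hr1⟩ hr0
  simp only [add_zero, sub_zero, mul_zero, sub_self] at this
  linarith

/-- Differentiating in `r` reduces this to the previous inequality with `s = p - 1`. -/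
lemma one_add_le_avg_rpow {p r : ℝ} (hp1 : 1 ≤ p) (hp2 : p ≤ 2) (hr0 : 0 ≤ r) (hr1 : r ≤ 1) :
    1 + p * (p - 1) / 2 * r ^ 2 ≤ ((1 + r) ^ p + (1 - r) ^ p) / 2 := by
  have hmono : MonotoneOn
      (fun r : ℝ => ((1 + r) ^ p + (1 - r) ^ p) / 2 - p * (p - 1) / 2 * r ^ 2)
      (Set.Icc 0 1) := by
    have hcont : ContinuousOn
        (fun r : ℝ => ((1 + r) ^ p + (1 - r) ^ p) / 2 - p * (p - 1) / 2 * r ^ 2)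
        (Set.Icc 0 1) := by
      refine ContinuousOn.sub (ContinuousOn.div_const (ContinuousOn.add ?_ ?_) _) (by fun_prop)
      · exact ContinuousOn.rpow_const (by fun_prop) fun _ _ => Or.inr (by linarith)
      · exact ContinuousOn.rpow_const (by fun_prop) fun _ _ => Or.inr (by linarith)
    have hder : ∀ x ∈ interior (Set.Icc (0 : ℝ) 1),
        HasDerivAt (fun r : ℝ => ((1 + r) ^ p + (1 - r) ^ p) / 2 - p * (p - 1) / 2 * r ^ 2)
          (p / 2 * ((1 + x) ^ (p - 1) - (1 - x) ^ (p - 1) - 2 * (p - 1) * x)) x := by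
      intro x hx
      have h1 : HasDerivAt (fun r : ℝ => (1 + r) ^ p) (1 * p * (1 + x) ^ (p - 1)) x :=
        ((hasDerivAt_id x).const_add 1).rpow_const (Or.inr hp1)
      have h2 : HasDerivAt (fun r : ℝ => (1 - r) ^ p) (-1 * p * (1 - x) ^ (p - 1)) x :=
        ((hasDerivAt_id x).const_sub 1).rpow_const (Or.inr hp1)
      refine (((h1.add h2).div_const 2).sub
        (((hasDerivAt_id x).pow 2).const_mul (p * (p - 1) / 2))).congr_deriv ?_
      simp only [id, Nat.cast_ofNat]
      ring
    refine monotoneOn_of_deriv_nonneg (convex_Icc 0 1) hcont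
      (fun x hx => (hder x hx).differentiableAt.differentiableWithinAt) fun x hx => ?_
    rw [(hder x hx).deriv]
    rw [interior_Icc] at hx
    refine mul_nonneg (by linarith) ?_
    linarith [two_mul_le_rpow_sub_rpow (s := p - 1) (by linarith) (by linarith) hx.1.le hx.2.le]
  have := hmono (Set.left_mem_Icc.2 zero_le_one) ⟨hr0, hr1⟩ hr0
  simp at this
  linarith

/-- Bonami's two-point inequality from exponent `1 + τ` to exponent `2`; the power of `2` comes from
using counting measure. Scaling to `a = M(1 + r)`, `b = M(1 - r)` leaves `1 + τr² ≤ V^(2/(1+τ))`.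
This follows from Bernoulli's inequality with exponent `(1 + τ)/2 ≤ 1` and the preceding lower bound
on `V`. -/
lemma two_point_quadratic_aux {τ a b : ℝ} (h0 : 0 ≤ τ) (h1 : τ ≤ 1) (hb : 0 ≤ b)
    (hab : b ≤ a) :
    (a + b) ^ 2 + τ * (a - b) ^ 2 ≤
      (2 ^ (1 - 1 / (1 + τ)) * (a ^ (1 + τ) + b ^ (1 + τ)) ^ (1 / (1 + τ))) ^ 2 := by
  have hp : 0 < 1 + τ := by linarith
  rcases (hb.trans hab).eq_or_lt with rfl | ha
  · obtain rfl : b = 0 := le_antisymm hab hb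
    simp only [add_zero, sub_zero]
    norm_num
    positivity
  set M := (a + b) / 2 with hM
  have hMpos : 0 < M := by positivity
  set r := (a - b) / (a + b) with hr
  have hr0 : 0 ≤ r := div_nonneg (by linarith) (by linarith)
  have hr1 : r ≤ 1 := (div_le_one (by linarith)).2 (by linarith)
  have hab' : a + b ≠ 0 := by positivity
  have ea : a = M * (1 + r) := by rw [hM, hr]; field_simp; ring
  have eb : b = M * (1 - r) := by rw [hM, hr]; field_simp; ring
  set V := ((1 + r) ^ (1 + τ) + (1 - r) ^ (1 + τ)) / 2 with hV
  have hVge : (1 + τ * r ^ 2) ^ ((1 + τ) / 2) ≤ V := by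
    refine le_trans ?_ (one_add_le_avg_rpow (p := 1 + τ) (by linarith) (by linarith) hr0 hr1)
    refine (rpow_one_add_le_one_add_mul_self (by nlinarith [sq_nonneg r]) (by linarith)
      (by linarith)).trans (le_of_eq ?_)
    ring
  have hV0 : 0 ≤ V := le_trans (by positivity) hVge
  have hsum : a ^ (1 + τ) + b ^ (1 + τ) = M ^ (1 + τ) * (2 * V) := by
    rw [ea, eb, Real.mul_rpow hMpos.le (by linarith), Real.mul_rpow hMpos.le (by linarith), hV]
    ring
  have hN : (2 : ℝ) ^ (1 - 1 / (1 + τ)) * (a ^ (1 + τ) + b ^ (1 + τ)) ^ (1 / (1 + τ)) =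
      2 * M * V ^ (1 / (1 + τ)) := by
    rw [hsum, Real.mul_rpow (by positivity) (by positivity), Real.mul_rpow (by norm_num) hV0,
      ← Real.rpow_mul hMpos.le, mul_one_div_cancel hp.ne', Real.rpow_one,
      Real.rpow_sub (by norm_num), Real.rpow_one]
    have : (2 : ℝ) ^ (1 / (1 + τ)) ≠ 0 := (Real.rpow_pos_of_pos (by norm_num) _).ne'
    field_simp
  have hroot : 1 + τ * r ^ 2 ≤ (V ^ (1 / (1 + τ))) ^ 2 := by
    have h2 := Real.rpow_le_rpow (by positivity) hVge (by positivity : 0 ≤ 2 / (1 + τ))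
    rw [← Real.rpow_mul (by positivity)] at h2
    have e1 : (1 + τ) / 2 * (2 / (1 + τ)) = 1 := by field_simp
    rw [e1, Real.rpow_one] at h2
    refine h2.trans (le_of_eq ?_)
    rw [← Real.rpow_natCast, ← Real.rpow_mul hV0]
    congr 1
    push_cast; ring
  rw [hN, mul_pow]
  calc (a + b) ^ 2 + τ * (a - b) ^ 2 = (2 * M) ^ 2 * (1 + τ * r ^ 2) := by rw [ea, eb]; ring
    _ ≤ _ := by gcongr

lemma two_point_quadratic {τ a b : ℝ} (h0 : 0 ≤ τ) (h1 : τ ≤ 1) (ha : 0 ≤ a) (hb : 0 ≤ b) :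
    (a + b) ^ 2 + τ * (a - b) ^ 2 ≤
      (2 ^ (1 - 1 / (1 + τ)) * (a ^ (1 + τ) + b ^ (1 + τ)) ^ (1 / (1 + τ))) ^ 2 := by
  rcases le_total b a with h | h
  · exact two_point_quadratic_aux h0 h1 hb h
  · have := two_point_quadratic_aux h0 h1 ha h
    rw [add_comm (b ^ (1 + τ))] at this
    linarith [this, (by ring : (b + a) ^ 2 + τ * (b - a) ^ 2 = (a + b) ^ 2 + τ * (a - b) ^ 2)]

/-- The `p`-norm, for the counting measure, of a function on a finite type. -/
noncomputable def lpSum {X : Type*} [Fintype X] (p : ℝ) (f : X → ℝ) : ℝ :=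
  (∑ x, f x ^ p) ^ (1 / p)

lemma lpSum_nonneg {X : Type*} [Fintype X] {p : ℝ} {f : X → ℝ} (hf : ∀ x, 0 ≤ f x) :
    0 ≤ lpSum p f :=
  Real.rpow_nonneg (Finset.sum_nonneg fun x _ => Real.rpow_nonneg (hf x) _) _

/-- The form equals `(f 0 + f 1)(g 0 + g 1) + τ (f 0 - f 1)(g 0 - g 1)`, so Cauchy–Schwarz with
weights `1, τ` reduces it to the quadratic bound for `f` and for `g`. -/
lemma two_point_bilinear {τ : ℝ} (h0 : 0 ≤ τ) (h1 : τ ≤ 1) {f g : ZMod 2 → ℝ}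
    (hf : ∀ a, 0 ≤ f a) (hg : ∀ a, 0 ≤ g a) :
    ∑ a, ∑ b, (1 + τ * (sgn a * sgn b)) * (f a * g b) ≤
      (2 ^ (1 - 1 / (1 + τ))) ^ 2 * (lpSum (1 + τ) f * lpSum (1 + τ) g) := by
  have hF := two_point_quadratic h0 h1 (hf 0) (hf 1)
  have hG := two_point_quadratic h0 h1 (hg 0) (hg 1)
  simp only [lpSum, sum_zmod_two, sgn_zero, sgn_one]
  set K : ℝ := 2 ^ (1 - 1 / (1 + τ))
  set F := (f 0 ^ (1 + τ) + f 1 ^ (1 + τ)) ^ (1 / (1 + τ))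
  set G := (g 0 ^ (1 + τ) + g 1 ^ (1 + τ)) ^ (1 / (1 + τ))
  have hK : 0 ≤ K := by positivity
  have hF0 : 0 ≤ F := Real.rpow_nonneg
    (add_nonneg (Real.rpow_nonneg (hf 0) _) (Real.rpow_nonneg (hf 1) _)) _
  have hG0 : 0 ≤ G := Real.rpow_nonneg
    (add_nonneg (Real.rpow_nonneg (hg 0) _) (Real.rpow_nonneg (hg 1) _)) _
  have key : ((f 0 + f 1) * (g 0 + g 1) + τ * ((f 0 - f 1) * (g 0 - g 1))) ^ 2 ≤
      (K * F * (K * G)) ^ 2 := by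
    rw [mul_pow (K * F)]
    refine le_trans ?_ (mul_le_mul hF hG (by positivity) (by positivity))
    nlinarith [mul_nonneg h0 (sq_nonneg ((f 0 + f 1) * (g 0 - g 1) - (f 0 - f 1) * (g 0 + g 1)))]
  have := abs_le_of_sq_le_sq' key (by positivity)
  linarith [this.2]

/-! ### Hypercontractivity on the discrete cube -/

/-- The noise kernel. -/
def kernel {n : ℕ} (τ : ℝ) (x y : Fin n → ZMod 2) : ℝ := ∏ i, (1 + τ * (sgn (x i) * sgn (y i)))

lemma sum_cons {M : Type*} [AddCommMonoid M] {n : ℕ} (F : (Fin (n + 1) → ZMod 2) → M) :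
    ∑ x, F x = ∑ a : ZMod 2, ∑ x : Fin n → ZMod 2, F (Fin.cons a x) := by
  rw [← (Fin.consEquiv fun _ : Fin (n + 1) => ZMod 2).sum_comp, Fintype.sum_prod_type]
  rfl

/-- Tensorization by peeling off one coordinate. The one-coordinate kernel `1 ± τ` is nonnegative,
so the inductive bound can be inserted under the outer sum. The two-point inequality then applies to
the norms of the slices, and iterated `p`-norms compose. The bilinear form makes Minkowski's
inequality unnecessary. -/
theorem hypercontractivity {τ : ℝ} (h0 : 0 ≤ τ) (h1 : τ ≤ 1) :
    ∀ (n : ℕ) (f g : (Fin n → ZMod 2) → ℝ), (∀ x, 0 ≤ f x) → (∀ x, 0 ≤ g x) →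
      ∑ x, ∑ y, kernel τ x y * (f x * g y) ≤
        ((2 ^ (1 - 1 / (1 + τ))) ^ 2) ^ n * (lpSum (1 + τ) f * lpSum (1 + τ) g) := by
  have hp : (0 : ℝ) < 1 + τ := by linarith
  intro n
  induction n with
  | zero =>
    intro f g hf hg
    simp [kernel, lpSum, ← Real.rpow_mul (hf _), ← Real.rpow_mul (hg _), mul_inv_cancel₀ hp.ne']
  | succ n ih =>
    intro f g hf hg
    set K : ℝ := (2 ^ (1 - 1 / (1 + τ))) ^ 2
    have hK : 0 ≤ K := by positivity
    have hcons : ∀ h : (Fin (n + 1) → ZMod 2) → ℝ, (∀ x, 0 ≤ h x) →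
        lpSum (1 + τ) (fun a : ZMod 2 => lpSum (1 + τ) fun x : Fin n → ZMod 2 => h (Fin.cons a x)) =
          lpSum (1 + τ) h := by
      intro h hh
      simp only [lpSum]
      rw [sum_cons]
      congr 1
      refine Finset.sum_congr rfl fun a _ => ?_
      rw [← Real.rpow_mul (Finset.sum_nonneg fun x _ => Real.rpow_nonneg (hh _) _),
        one_div_mul_cancel hp.ne', Real.rpow_one]
    calc ∑ x, ∑ y, kernel τ x y * (f x * g y)
        = ∑ a : ZMod 2, ∑ b : ZMod 2, (1 + τ * (sgn a * sgn b)) *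
            ∑ x : Fin n → ZMod 2, ∑ y : Fin n → ZMod 2,
              kernel τ x y * (f (Fin.cons a x) * g (Fin.cons b y)) := by
          rw [sum_cons]
          refine Finset.sum_congr rfl fun a _ => ?_
          simp_rw [sum_cons (n := n) (M := ℝ)]
          rw [Finset.sum_comm]
          refine Finset.sum_congr rfl fun b _ => ?_
          simp only [Finset.mul_sum]
          refine Finset.sum_congr rfl fun x _ => Finset.sum_congr rfl fun y _ => ?_
          simp only [kernel, Fin.prod_univ_succ, Fin.cons_zero, Fin.cons_succ]
          ring
      _ ≤ ∑ a : ZMod 2, ∑ b : ZMod 2, (1 + τ * (sgn a * sgn b)) *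
            (K ^ n * (lpSum (1 + τ) (fun x : Fin n → ZMod 2 => f (Fin.cons a x)) *
              lpSum (1 + τ) (fun x : Fin n → ZMod 2 => g (Fin.cons b x)))) := by
          refine Finset.sum_le_sum fun a _ => Finset.sum_le_sum fun b _ => ?_
          refine mul_le_mul_of_nonneg_left (ih _ _ (fun _ => hf _) fun _ => hg _) ?_
          rcases zmod_two_cases a with rfl | rfl <;> rcases zmod_two_cases b with rfl | rfl <;>
            simp <;> linarith
      _ = K ^ n * ∑ a : ZMod 2, ∑ b : ZMod 2, (1 + τ * (sgn a * sgn b)) *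
            (lpSum (1 + τ) (fun x : Fin n → ZMod 2 => f (Fin.cons a x)) *
              lpSum (1 + τ) (fun x : Fin n → ZMod 2 => g (Fin.cons b x))) := by
          simp only [Finset.mul_sum]
          refine Finset.sum_congr rfl fun a _ => Finset.sum_congr rfl fun b _ => ?_
          ring
      _ ≤ K ^ n * (K * (lpSum (1 + τ) f * lpSum (1 + τ) g)) := by
          refine mul_le_mul_of_nonneg_left ?_ (by positivity)
          rw [← hcons f hf, ← hcons g hg]
          exact two_point_bilinear h0 h1 (fun a => lpSum_nonneg fun _ => hf _)
            fun a => lpSum_nonneg fun _ => hg _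
      _ = _ := by ring

/-- The level inequality: the noise form of a set of measure at least `exp (-L)`. -/
lemma sum_kernel_le {n : ℕ} {τ L : ℝ} (h0 : 0 ≤ τ) (h1 : τ ≤ 1) (hL : 0 ≤ L)
    (A : Finset (Fin n → ZMod 2)) (hA : 2 ^ n * Real.exp (-L) ≤ (A.card : ℝ)) :
    ∑ x ∈ A, ∑ y ∈ A, kernel τ x y ≤ (A.card : ℝ) ^ 2 * Real.exp (2 * τ * L) := by
  classical
  have hp : (0 : ℝ) < 1 + τ := by linarith
  have hcard : (0 : ℝ) < A.card := lt_of_lt_of_le (by positivity) hA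
  have h := hypercontractivity h0 h1 n (fun x => if x ∈ A then 1 else 0)
    (fun x => if x ∈ A then 1 else 0) (fun x => by split_ifs <;> simp)
    (fun x => by split_ifs <;> simp)
  have hlp : lpSum (1 + τ) (fun x : Fin n → ZMod 2 => if x ∈ A then (1 : ℝ) else 0) =
      (A.card : ℝ) ^ (1 / (1 + τ)) := by
    simp [lpSum, apply_ite (fun t : ℝ => t ^ (1 + τ)), Real.zero_rpow hp.ne']
  rw [hlp] at h
  have hlhs : ∑ x, ∑ y, kernel τ x y *
      ((if x ∈ A then (1 : ℝ) else 0) * (if y ∈ A then (1 : ℝ) else 0)) =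
      ∑ x ∈ A, ∑ y ∈ A, kernel τ x y := by
    rw [← Finset.sum_subset (Finset.subset_univ A) fun x _ hx => by simp [hx]]
    refine Finset.sum_congr rfl fun x hx => ?_
    rw [← Finset.sum_subset (Finset.subset_univ A) fun y _ hy => by simp [hy]]
    exact Finset.sum_congr rfl fun y hy => by simp [hx, hy]
  rw [hlhs] at h
  refine h.trans ?_
  set P : ℝ := (A.card : ℝ)
  have e1 : ((2 : ℝ) ^ (1 - 1 / (1 + τ))) = 2 ^ (τ / (1 + τ)) := by
    congr 1; field_simp; ring
  have e2 : P = P ^ (1 / (1 + τ)) * P ^ (τ / (1 + τ)) := by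
    rw [← Real.rpow_add hcard]
    have : 1 / (1 + τ) + τ / (1 + τ) = 1 := by field_simp
    rw [this, Real.rpow_one]
  have h2n : (2 : ℝ) ^ n ≤ P * Real.exp L := by
    have := mul_le_mul_of_nonneg_right hA (Real.exp_pos L).le
    rwa [mul_assoc, ← Real.exp_add, neg_add_cancel, Real.exp_zero, mul_one] at this
  -- The density hypothesis trades the normalizing power of `2^n` for a power of the cardinality,
  -- which completes `P^(2/(1+τ))` to `P²` at the cost of `exp (2τL)`.
  have h3 : ((2 : ℝ) ^ (τ / (1 + τ))) ^ n ≤ P ^ (τ / (1 + τ)) * Real.exp (τ * L) := by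
    rw [← Real.rpow_natCast, ← Real.rpow_mul (by norm_num), mul_comm, Real.rpow_mul (by norm_num),
      Real.rpow_natCast]
    refine (Real.rpow_le_rpow (by positivity) h2n (by positivity)).trans ?_
    rw [Real.mul_rpow hcard.le (Real.exp_pos _).le, ← Real.exp_mul]
    refine mul_le_mul_of_nonneg_left (Real.exp_le_exp.2 ?_) (Real.rpow_nonneg hcard.le _)
    rw [mul_comm]
    exact mul_le_mul_of_nonneg_right (div_le_self h0 (by linarith)) hL
  rw [e1, ← pow_mul, mul_comm 2 n, pow_mul]
  calc _ ≤ (P ^ (τ / (1 + τ)) * Real.exp (τ * L)) ^ 2 *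
        (P ^ (1 / (1 + τ)) * P ^ (1 / (1 + τ))) :=
      mul_le_mul_of_nonneg_right (pow_le_pow_left₀ (by positivity) h3 2) (mul_self_nonneg _)
    _ = (P ^ (1 / (1 + τ)) * P ^ (τ / (1 + τ))) ^ 2 * (Real.exp (τ * L)) ^ 2 := by ring
    _ = P ^ 2 * Real.exp (2 * τ * L) := by
      rw [← e2, ← Real.exp_nat_mul, Nat.cast_ofNat, mul_assoc]

/-! ### Exponential moments of the correlation of two points of a large set -/

/-- The correlation of two points of the discrete cube, viewed as vectors of signs. -/
def corr {n : ℕ} (x y : Fin n → ZMod 2) : ℝ := ∑ i, sgn (x i) * sgn (y i)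

/-- A power sum of squares of character sums. -/
lemma sum_prod_one_add {X ι : Type*} [DecidableEq ι] (A : Finset X) (I : Finset ι)
    (χ : X → ι → ℝ) (r : ℝ) :
    ∑ x ∈ A, ∑ y ∈ A, ∏ i ∈ I, (1 + r * (χ x i * χ y i)) =
      ∑ T ∈ I.powerset, r ^ T.card * (∑ x ∈ A, ∏ i ∈ T, χ x i) ^ 2 := by
  simp only [Finset.prod_one_add, Finset.prod_mul_distrib, Finset.prod_const]
  have : ∀ x ∈ A, ∑ y ∈ A, ∑ T ∈ I.powerset, r ^ T.card * ((∏ i ∈ T, χ x i) * ∏ i ∈ T, χ y i) =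
      ∑ T ∈ I.powerset, ∑ y ∈ A, r ^ T.card * ((∏ i ∈ T, χ x i) * ∏ i ∈ T, χ y i) :=
    fun x _ => Finset.sum_comm
  rw [Finset.sum_congr rfl this, Finset.sum_comm]
  refine Finset.sum_congr rfl fun T _ => ?_
  rw [sq, Finset.sum_mul_sum, Finset.mul_sum]
  refine Finset.sum_congr rfl fun x _ => ?_
  rw [Finset.mul_sum]

lemma sum_kernel_eq {n : ℕ} (τ : ℝ) (A : Finset (Fin n → ZMod 2)) :
    ∑ x ∈ A, ∑ y ∈ A, kernel τ x y =
      ∑ T : Finset (Fin n), τ ^ T.card * (∑ x ∈ A, ∏ i ∈ T, sgn (x i)) ^ 2 := by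
  simp only [kernel]
  rw [sum_prod_one_add A Finset.univ (fun x i => sgn (x i)) τ, Finset.powerset_univ]

/-- Odd powers cancel, so apart from `k = 0` only exponents at least `2` survive, and shrinking `τ₀`
to `τ` gains at least `(τ / τ₀)²` there. -/
lemma even_part_pow_le {τ τ₀ : ℝ} (h0 : 0 ≤ τ) (hτ : τ ≤ τ₀) (hτ₀ : 0 < τ₀) (k : ℕ) :
    (τ ^ k + (-τ) ^ k) / 2 ≤ (if k = 0 then 1 else 0) + (τ / τ₀) ^ 2 * τ₀ ^ k := by
  match k with
  | 0 => simp; positivity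
  | 1 => simp; positivity
  | k + 2 =>
    have h1 : (-τ) ^ (k + 2) ≤ τ ^ (k + 2) := by
      refine (le_abs_self _).trans (le_of_eq ?_)
      rw [abs_pow, abs_neg, abs_of_nonneg h0]
    have h2 : τ ^ (k + 2) ≤ (τ / τ₀) ^ 2 * τ₀ ^ (k + 2) := by
      have : (τ / τ₀) ^ 2 * τ₀ ^ (k + 2) = τ ^ 2 * τ₀ ^ k := by field_simp; ring
      rw [this, pow_add, mul_comm]
      gcongr
    simp only [Nat.add_eq_zero_iff, OfNat.ofNat_ne_zero, and_false, if_false, zero_add]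
    linarith

lemma sum_kernel_even_le {n : ℕ} {τ L : ℝ} (h0 : 0 ≤ τ) (h1 : τ ≤ 1) (hL : 1 ≤ L)
    (A : Finset (Fin n → ZMod 2)) (hA : 2 ^ n * Real.exp (-L) ≤ (A.card : ℝ)) :
    (∑ x ∈ A, ∑ y ∈ A, kernel τ x y + ∑ x ∈ A, ∑ y ∈ A, kernel (-τ) x y) / 2 ≤
      (A.card : ℝ) ^ 2 * (1 + (τ * L) ^ 2 * Real.exp (2 + 2 * (τ * L))) := by
  have hLpos : 0 < L := by linarith
  -- At noise rate `1 / L` the level inequality loses only a constant factor `e²`, while `τ / τ₀ ≤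
  -- τL`. The assumption `1 ≤ L` keeps `τ₀ ≤ 1`.
  set τ₀ := max τ (1 / L) with hτ₀
  have hpos : 0 < τ₀ := lt_max_of_lt_right (by positivity)
  have hτ₀1 : τ₀ ≤ 1 := max_le h1 ((div_le_one hLpos).2 hL)
  have hW := sum_kernel_le hpos.le hτ₀1 hLpos.le A hA
  have hstep : (∑ x ∈ A, ∑ y ∈ A, kernel τ x y + ∑ x ∈ A, ∑ y ∈ A, kernel (-τ) x y) / 2 ≤
      (A.card : ℝ) ^ 2 + (τ / τ₀) ^ 2 * ∑ x ∈ A, ∑ y ∈ A, kernel τ₀ x y := by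
    simp only [sum_kernel_eq]
    have hempty : (A.card : ℝ) ^ 2 = ∑ T : Finset (Fin n), (if T.card = 0 then 1 else 0) *
        (∑ x ∈ A, ∏ i ∈ T, sgn (x i)) ^ 2 := by
      simp [Finset.card_eq_zero]
    rw [hempty, ← Finset.sum_add_distrib, Finset.sum_div, Finset.mul_sum, ← Finset.sum_add_distrib]
    refine Finset.sum_le_sum fun T _ => ?_
    have := mul_le_mul_of_nonneg_right (even_part_pow_le h0 (le_max_left τ (1 / L)) hpos T.card)
      (sq_nonneg (∑ x ∈ A, ∏ i ∈ T, sgn (x i)))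
    refine le_trans (le_of_eq ?_) (this.trans (le_of_eq ?_))
    · ring
    · rw [← hτ₀]; ring
  have ha : τ / τ₀ ≤ τ * L := by
    rw [div_le_iff₀ hpos]
    have : 1 ≤ L * τ₀ := by
      calc (1 : ℝ) = L * (1 / L) := by field_simp
        _ ≤ _ := by gcongr; exact le_max_right _ _
    nlinarith
  have hb : 2 * τ₀ * L ≤ 2 + 2 * (τ * L) := by
    have : τ₀ ≤ τ + 1 / L := max_le (by linarith [one_div_pos.2 hLpos]) (by linarith)
    calc 2 * τ₀ * L ≤ 2 * (τ + 1 / L) * L := by gcongr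
      _ = _ := by field_simp; ring
  calc _ ≤ _ := hstep
    _ ≤ (A.card : ℝ) ^ 2 + (τ * L) ^ 2 *
        ((A.card : ℝ) ^ 2 * Real.exp (2 + 2 * (τ * L))) := by
      refine add_le_add le_rfl (mul_le_mul (pow_le_pow_left₀ (by positivity) ha 2) ?_ ?_
        (by positivity))
      · exact hW.trans (mul_le_mul_of_nonneg_left (Real.exp_le_exp.2 hb) (by positivity))
      · rw [sum_kernel_eq]; positivity
    _ = _ := by ring

/-- For a sign `ξ`, `exp (sξ) = cosh s * (1 + tanh s * ξ)`; the product over coordinates turns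
exponential moments into noise kernels. -/
lemma exp_mul_corr {n : ℕ} (s : ℝ) (x y : Fin n → ZMod 2) :
    Real.exp (s * corr x y) = Real.cosh s ^ n * kernel (Real.tanh s) x y := by
  have hc : Real.cosh s ≠ 0 := (Real.cosh_pos s).ne'
  have h : ∀ a b : ZMod 2, Real.exp (s * (sgn a * sgn b)) =
      Real.cosh s * (1 + Real.tanh s * (sgn a * sgn b)) := by
    intro a b
    have e1 : Real.cosh s * (1 + Real.tanh s) = Real.exp s := by
      rw [Real.tanh_eq_sinh_div_cosh, ← Real.cosh_add_sinh]; field_simp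
    have e2 : Real.cosh s * (1 + -Real.tanh s) = Real.exp (-s) := by
      rw [Real.tanh_eq_sinh_div_cosh, ← Real.cosh_sub_sinh]; field_simp; ring
    rcases zmod_two_cases a with rfl | rfl <;> rcases zmod_two_cases b with rfl | rfl <;>
      simp only [sgn_zero, sgn_one, mul_one, mul_neg, neg_neg, e1, e2]
  rw [corr, Finset.mul_sum, Real.exp_sum, kernel, Finset.prod_congr rfl fun i _ => h (x i) (y i),
    Finset.prod_mul_distrib]
  simp

lemma sum_cosh_corr_le {n : ℕ} {L : ℝ} (s : ℝ) (hL : 1 ≤ L)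
    (A : Finset (Fin n → ZMod 2)) (hA : 2 ^ n * Real.exp (-L) ≤ (A.card : ℝ)) :
    ∑ x ∈ A, ∑ y ∈ A, Real.cosh (s * corr x y) ≤ (A.card : ℝ) ^ 2 *
      (Real.exp (n * s ^ 2 / 2) * (1 + (s * L) ^ 2 * Real.exp (2 + 2 * (|s| * L)))) := by
  wlog hs : 0 ≤ s generalizing s
  · have := this (-s) (by linarith)
    simpa only [neg_mul, Real.cosh_neg, abs_neg, even_two.neg_pow] using this
  have hc : 0 < Real.cosh s := Real.cosh_pos s
  have ht0 : 0 ≤ Real.tanh s := by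
    rw [Real.tanh_eq_sinh_div_cosh]; exact div_nonneg (Real.sinh_nonneg_iff.2 hs) hc.le
  have ht1 : Real.tanh s ≤ 1 := (Real.tanh_lt_one s).le
  have hts : Real.tanh s ≤ s := by
    rw [Real.tanh_eq_sinh_div_cosh, div_le_iff₀ hc]
    have hmono : MonotoneOn (fun s : ℝ => s * Real.cosh s - Real.sinh s) (Set.Ici 0) := by
      have hd : ∀ x : ℝ, HasDerivAt (fun s : ℝ => s * Real.cosh s - Real.sinh s)
          (x * Real.sinh x) x := fun x =>
        (((hasDerivAt_id x).mul (Real.hasDerivAt_cosh x)).sub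
          (Real.hasDerivAt_sinh x)).congr_deriv (by simp)
      refine monotoneOn_of_deriv_nonneg (convex_Ici 0)
        (fun x _ => (hd x).continuousAt.continuousWithinAt)
        (fun x _ => (hd x).differentiableAt.differentiableWithinAt) fun x hx => ?_
      rw [interior_Ici] at hx
      rw [(hd x).deriv]
      exact mul_nonneg (le_of_lt hx) (Real.sinh_nonneg_iff.2 (le_of_lt hx))
    have := hmono (Set.self_mem_Ici) hs hs
    simp at this
    linarith
  have hsum : ∑ x ∈ A, ∑ y ∈ A, Real.cosh (s * corr x y) = Real.cosh s ^ n *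
      ((∑ x ∈ A, ∑ y ∈ A, kernel (Real.tanh s) x y +
        ∑ x ∈ A, ∑ y ∈ A, kernel (-Real.tanh s) x y) / 2) := by
    simp only [← Finset.sum_add_distrib, Finset.sum_div, Finset.mul_sum]
    refine Finset.sum_congr rfl fun x _ => Finset.sum_congr rfl fun y _ => ?_
    have h2 := exp_mul_corr (-s) x y
    rw [Real.tanh_neg, Real.cosh_neg] at h2
    rw [Real.cosh_eq, exp_mul_corr, ← neg_mul, h2]
    ring
  rw [hsum]
  have hcn : Real.cosh s ^ n ≤ Real.exp (n * s ^ 2 / 2) := by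
    refine (pow_le_pow_left₀ hc.le (Real.cosh_le_exp_half_sq s) n).trans (le_of_eq ?_)
    rw [← Real.exp_nat_mul]; congr 1; ring
  have hE := sum_kernel_even_le ht0 ht1 hL A hA
  have hL0 : 0 ≤ L := by linarith
  have hmul : Real.tanh s * L ≤ s * L := by gcongr
  calc _ ≤ Real.exp (n * s ^ 2 / 2) * ((A.card : ℝ) ^ 2 *
        (1 + (s * L) ^ 2 * Real.exp (2 + 2 * (s * L)))) := by
        refine mul_le_mul hcn (hE.trans ?_) ?_ (Real.exp_pos _).le
        · gcongr
        -- The half-sum of kernels is nonnegative because, times `cosh s ^ n`, it is a sum of values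
        -- of `cosh`.
        · have : 0 < Real.cosh s ^ n := by positivity
          refine (mul_nonneg_iff_of_pos_left this).1 ?_
          rw [← hsum]
          exact Finset.sum_nonneg fun _ _ => Finset.sum_nonneg fun _ _ => (Real.cosh_pos _).le
    _ = _ := by rw [abs_of_nonneg hs]; ring

/-! ### Gaussian linearization -/

lemma exp_gaussian_shift (b g : ℝ) :
    Real.exp (-(1 / 2) * g ^ 2) * Real.exp (b * g) =
      Real.exp (b ^ 2 / 2) * Real.exp (-(1 / 2) * (g - b) ^ 2) := by
  rw [← Real.exp_add, ← Real.exp_add]; congr 1; ring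

lemma integrable_gaussian_exp (b : ℝ) :
    MeasureTheory.Integrable fun g : ℝ => Real.exp (-(1 / 2) * g ^ 2) * Real.exp (b * g) := by
  simp only [exp_gaussian_shift]
  exact ((integrable_exp_neg_mul_sq (b := 1 / 2) (by norm_num)).comp_sub_right b).const_mul _

lemma integral_gaussian_exp (b : ℝ) :
    ∫ g : ℝ, Real.exp (-(1 / 2) * g ^ 2) * Real.exp (b * g) =
      √(2 * Real.pi) * Real.exp (b ^ 2 / 2) := by
  simp only [exp_gaussian_shift]
  rw [MeasureTheory.integral_const_mul,
    MeasureTheory.integral_sub_right_eq_self (fun g : ℝ => Real.exp (-(1 / 2) * g ^ 2)) b,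
    integral_gaussian, mul_comm]
  congr 2
  ring

lemma gaussian_cosh_eq (b g : ℝ) : Real.exp (-(1 / 2) * g ^ 2) * Real.cosh (b * g) =
    (Real.exp (-(1 / 2) * g ^ 2) * Real.exp (b * g) +
      Real.exp (-(1 / 2) * g ^ 2) * Real.exp (-b * g)) / 2 := by
  rw [Real.cosh_eq, neg_mul b]; ring

lemma integrable_gaussian_cosh (b : ℝ) :
    MeasureTheory.Integrable fun g : ℝ => Real.exp (-(1 / 2) * g ^ 2) * Real.cosh (b * g) := by
  simp only [gaussian_cosh_eq]
  exact ((integrable_gaussian_exp b).add (integrable_gaussian_exp (-b))).div_const 2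

lemma integral_gaussian_cosh (b : ℝ) :
    ∫ g : ℝ, Real.exp (-(1 / 2) * g ^ 2) * Real.cosh (b * g) =
      √(2 * Real.pi) * Real.exp (b ^ 2 / 2) := by
  simp only [gaussian_cosh_eq]
  rw [MeasureTheory.integral_div,
    MeasureTheory.integral_add (integrable_gaussian_exp b) (integrable_gaussian_exp (-b)),
    integral_gaussian_exp, integral_gaussian_exp, neg_sq]
  ring

/-- The exponent `3/20` is small enough to be absorbed by the Gaussian weight: `1/2 - 1/20 - 3/20 =
3/10`. -/
lemma sq_mul_exp_le {u g : ℝ} (hu : u ≤ 1 / 20) :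
    g ^ 2 * Real.exp (2 + 2 * (u * |g|)) ≤ 80 * Real.exp (3 / 20 * g ^ 2) := by
  have h1 : g ^ 2 ≤ 10 * Real.exp (1 / 10 * g ^ 2) := by
    linarith [Real.add_one_le_exp (1 / 10 * g ^ 2)]
  have h2 : 2 + 2 * (u * |g|) ≤ 41 / 20 + 1 / 20 * g ^ 2 := by
    have : u * |g| ≤ 1 / 20 * |g| := by gcongr
    nlinarith [sq_nonneg (|g| - 1), sq_abs g]
  have h3 : Real.exp (41 / 20) ≤ 8 := by
    have : Real.exp (41 / 20) = Real.exp 1 * Real.exp 1 * Real.exp (1 / 20) := by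
      rw [← Real.exp_add, ← Real.exp_add]; norm_num
    rw [this]
    have e1 := Real.exp_one_lt_d9
    have e2 : Real.exp (1 / 20) ≤ 20 / 19 := by
      have h := Real.add_one_le_exp (-(1 / 20) : ℝ)
      rw [Real.exp_neg] at h
      have hp := Real.exp_pos (1 / 20)
      have h' := mul_le_mul_of_nonneg_right h hp.le
      rw [inv_mul_cancel₀ hp.ne'] at h'
      linarith
    have e3 : Real.exp 1 * Real.exp 1 ≤ 2.7182818286 * 2.7182818286 := by gcongr
    exact (mul_le_mul e3 e2 (Real.exp_pos _).le (by norm_num)).trans (by norm_num)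
  calc g ^ 2 * Real.exp (2 + 2 * (u * |g|))
      ≤ (10 * Real.exp (1 / 10 * g ^ 2)) * Real.exp (41 / 20 + 1 / 20 * g ^ 2) := by gcongr
    _ = 10 * Real.exp (41 / 20) * Real.exp (3 / 20 * g ^ 2) := by
      rw [Real.exp_add, show (3 / 20 : ℝ) * g ^ 2 = 1 / 10 * g ^ 2 + 1 / 20 * g ^ 2 by ring,
        Real.exp_add]
      ring
    _ ≤ 10 * 8 * Real.exp (3 / 20 * g ^ 2) := by gcongr
    _ = _ := by ring

/-- For a standard Gaussian `g`, `exp (q c² / 2)` is the expectation of `cosh (√q g c)`. The bound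
on `cosh` sums is applied at `s = √q g` and integrated: `exp (nqg²/2)` yields `(1 - nq)^(-1/2)`, the
rest yields `qL²`. -/
lemma sum_exp_corr_sq_le {n : ℕ} {L q : ℝ} (hq : 0 ≤ q) (hnq : n * q ≤ 1 / 10) (hL : 1 ≤ L)
    (hqL : √q * L ≤ 1 / 20)
    (A : Finset (Fin n → ZMod 2)) (hA : 2 ^ n * Real.exp (-L) ≤ (A.card : ℝ)) :
    ∑ x ∈ A, ∑ y ∈ A, Real.exp (q * corr x y ^ 2 / 2) ≤
      (A.card : ℝ) ^ 2 * ((√(1 - n * q))⁻¹ + 160 * (q * L ^ 2)) := by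
  set P : ℝ := (A.card : ℝ) ^ 2 with hP
  have hP0 : 0 ≤ P := by positivity
  have hpi : 0 < √(2 * Real.pi) := by positivity
  have hL0 : 0 ≤ L := by linarith
  set t : ℝ := n * q with ht
  have ht0 : 0 ≤ t := by positivity
  have hint : √(2 * Real.pi) * ∑ x ∈ A, ∑ y ∈ A, Real.exp (q * corr x y ^ 2 / 2) =
      ∫ g : ℝ, Real.exp (-(1 / 2) * g ^ 2) *
        ∑ x ∈ A, ∑ y ∈ A, Real.cosh (√q * g * corr x y) := by
    simp only [Finset.mul_sum]
    have hF : ∀ x y : Fin n → ZMod 2, (fun g : ℝ => Real.exp (-(1 / 2) * g ^ 2) *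
        Real.cosh (√q * g * corr x y)) = fun g : ℝ => Real.exp (-(1 / 2) * g ^ 2) *
        Real.cosh (√q * corr x y * g) := by
      intro x y; funext g; congr 2; ring
    rw [MeasureTheory.integral_finsetSum]
    · refine Finset.sum_congr rfl fun x _ => ?_
      rw [MeasureTheory.integral_finsetSum]
      · refine Finset.sum_congr rfl fun y _ => ?_
        rw [hF, integral_gaussian_cosh, mul_pow, Real.sq_sqrt hq]
      · intro y _
        rw [hF]; exact integrable_gaussian_cosh _
    · intro x _
      refine MeasureTheory.integrable_finsetSum _ fun y _ => ?_
      rw [hF]; exact integrable_gaussian_cosh _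
  have hb1 : 0 < (1 - t) / 2 := by linarith
  have hb2 : (0 : ℝ) < 3 / 10 := by norm_num
  have hI1 := integrable_exp_neg_mul_sq hb1
  have hI2 := integrable_exp_neg_mul_sq hb2
  have hpt : ∀ g : ℝ, Real.exp (-(1 / 2) * g ^ 2) *
        ∑ x ∈ A, ∑ y ∈ A, Real.cosh (√q * g * corr x y) ≤
      P * (Real.exp (-((1 - t) / 2) * g ^ 2) +
        80 * (q * L ^ 2) * Real.exp (-(3 / 10) * g ^ 2)) := by
    intro g
    have h1 := sum_cosh_corr_le (√q * g) hL A hA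
    rw [← hP] at h1
    have h2 := sq_mul_exp_le (g := g) hqL
    have e1 : (√q * g * L) ^ 2 * Real.exp (2 + 2 * (|√q * g| * L)) =
        (q * L ^ 2) * (g ^ 2 * Real.exp (2 + 2 * (√q * L * |g|))) := by
      rw [mul_pow, mul_pow, Real.sq_sqrt hq, abs_mul, abs_of_nonneg (Real.sqrt_nonneg q)]
      rw [show √q * |g| * L = √q * L * |g| by ring]
      ring
    have e2 : (n : ℝ) * (√q * g) ^ 2 / 2 = t / 2 * g ^ 2 := by
      rw [mul_pow, Real.sq_sqrt hq]; ring
    rw [e1, e2] at h1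
    have h3 : Real.exp (t / 2 * g ^ 2) ≤ Real.exp (1 / 20 * g ^ 2) := by
      exact Real.exp_le_exp.2 (mul_le_mul_of_nonneg_right (by linarith) (sq_nonneg g))
    calc _ ≤ Real.exp (-(1 / 2) * g ^ 2) * (P * (Real.exp (t / 2 * g ^ 2) *
          (1 + (q * L ^ 2) * (80 * Real.exp (3 / 20 * g ^ 2))))) := by
          refine mul_le_mul_of_nonneg_left (h1.trans ?_) (Real.exp_pos _).le
          gcongr
      _ = P * (Real.exp (-(1 / 2) * g ^ 2) * Real.exp (t / 2 * g ^ 2) +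
          80 * (q * L ^ 2) * (Real.exp (-(1 / 2) * g ^ 2) * Real.exp (t / 2 * g ^ 2) *
            Real.exp (3 / 20 * g ^ 2))) := by ring
      _ ≤ P * (Real.exp (-(1 / 2) * g ^ 2) * Real.exp (t / 2 * g ^ 2) +
          80 * (q * L ^ 2) * (Real.exp (-(1 / 2) * g ^ 2) * Real.exp (1 / 20 * g ^ 2) *
            Real.exp (3 / 20 * g ^ 2))) := by gcongr
      _ = _ := by
          simp only [← Real.exp_add]
          congr 3
          · ring
          · congr 1; ring
  have hle : √(2 * Real.pi) * ∑ x ∈ A, ∑ y ∈ A, Real.exp (q * corr x y ^ 2 / 2) ≤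
      P * (√(Real.pi / ((1 - t) / 2)) + 80 * (q * L ^ 2) * √(Real.pi / (3 / 10))) := by
    rw [hint, ← integral_gaussian, ← integral_gaussian, ← MeasureTheory.integral_const_mul,
      ← MeasureTheory.integral_add hI1 (hI2.const_mul _), ← MeasureTheory.integral_const_mul]
    refine MeasureTheory.integral_mono_of_nonneg (Eventually.of_forall fun g => ?_)
      ((hI1.add (hI2.const_mul _)).const_mul _) (Eventually.of_forall hpt)
    exact mul_nonneg (Real.exp_pos _).le
      (Finset.sum_nonneg fun _ _ => Finset.sum_nonneg fun _ _ => (Real.cosh_pos _).le)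
  have s1 : √(Real.pi / ((1 - t) / 2)) = √(2 * Real.pi) * (√(1 - t))⁻¹ := by
    rw [← Real.sqrt_inv, ← Real.sqrt_mul (by positivity)]
    congr 1
    have : (1 - t) ≠ 0 := by linarith
    field_simp
  -- The true ratio is `√(5/3)`; rounding it to `2` turns `80` into `160`.
  have s2 : √(Real.pi / (3 / 10)) ≤ √(2 * Real.pi) * 2 := by
    rw [Real.sqrt_le_left (by positivity), mul_pow, Real.sq_sqrt (by positivity)]
    linarith [Real.pi_pos]
  refine le_of_mul_le_mul_left (hle.trans ?_) hpi
  rw [s1]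
  calc _ ≤ P * (√(2 * Real.pi) * (√(1 - t))⁻¹ + 80 * (q * L ^ 2) * (√(2 * Real.pi) * 2)) := by
        gcongr
    _ = _ := by ring

/-! ### Sums and products over all pairs of vertices -/

/-- The sign of an edge: the product of the signs of its endpoints. -/
def edgeSgn {n : ℕ} (x : Fin n → ZMod 2) (e : Sym2 (Fin n)) : ℝ :=
  Sym2.lift ⟨fun u v => sgn (x u) * sgn (x v), fun _ _ => mul_comm _ _⟩ e

@[simp] lemma edgeSgn_mk {n : ℕ} (x : Fin n → ZMod 2) (u v : Fin n) :
    edgeSgn x s(u, v) = sgn (x u) * sgn (x v) := rfl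

lemma edgeSgn_mul_self {n : ℕ} (x : Fin n → ZMod 2) (e : Sym2 (Fin n)) :
    edgeSgn x e * edgeSgn x e = 1 := by
  induction e with
  | _ u v =>
    rw [edgeSgn_mk, mul_mul_mul_comm, sgn_mul_self, sgn_mul_self, one_mul]

lemma sum_vertexPair {n : ℕ} (F : Sym2 (Fin n) → ℝ) :
    ∑ e : VertexPair n, F e = ∑ e : Fin n × Fin n with e.1 < e.2, F s(e.1, e.2) := by
  have h1 : ∑ e : VertexPair n, F e = ∑ e : Sym2 (Fin n) with ¬ e.IsDiag, F e :=
    (Finset.sum_subtype _ (by simp) F).symm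
  rw [h1, ← Finset.sym2_univ, Finset.sum_sym2_filter_not_isDiag]
  refine Finset.sum_congr ?_ fun _ _ => rfl
  ext e
  simp only [Finset.mem_filter, Finset.mem_offDiag, Finset.mem_univ, true_and, ne_eq,
    and_iff_right_iff_imp]
  exact fun h => h.ne

lemma two_mul_sum_lt {n : ℕ} (a : Fin n → ℝ) :
    2 * ∑ e : Fin n × Fin n with e.1 < e.2, a e.1 * a e.2 = (∑ i, a i) ^ 2 - ∑ i, a i ^ 2 := by
  have hswap : ∑ e : Fin n × Fin n with e.2 < e.1, a e.1 * a e.2 =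
      ∑ e : Fin n × Fin n with e.1 < e.2, a e.1 * a e.2 := by
    refine Finset.sum_equiv (Equiv.prodComm _ _) (by simp) fun e _ => ?_
    simp [mul_comm]
  have hdiag : ∑ e : Fin n × Fin n with e.1 = e.2, a e.1 * a e.2 = ∑ i, a i ^ 2 := by
    rw [Finset.sum_filter, Fintype.sum_prod_type]
    simp [sq]
  have hall : (∑ i, a i) ^ 2 = ∑ e : Fin n × Fin n, a e.1 * a e.2 := by
    rw [sq, Finset.sum_mul_sum, Fintype.sum_prod_type]
  have hpt : ∀ e : Fin n × Fin n, a e.1 * a e.2 = (if e.1 < e.2 then a e.1 * a e.2 else 0) +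
      (if e.2 < e.1 then a e.1 * a e.2 else 0) + (if e.1 = e.2 then a e.1 * a e.2 else 0) := by
    intro e
    rcases lt_trichotomy e.1 e.2 with h | h | h
    · simp [h, h.ne, h.not_gt]
    · simp [h]
    · simp [h, h.ne', h.not_gt]
  rw [hall, Fintype.sum_congr _ _ hpt, Finset.sum_add_distrib, Finset.sum_add_distrib,
    ← Finset.sum_filter, ← Finset.sum_filter, ← Finset.sum_filter, hswap, hdiag]
  ring

lemma sum_edgeSgn {n : ℕ} (x y : Fin n → ZMod 2) :
    ∑ e : VertexPair n, edgeSgn x e * edgeSgn y e = (corr x y ^ 2 - n) / 2 := by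
  have h := two_mul_sum_lt fun i => sgn (x i) * sgn (y i)
  have h1 : ∑ i, (sgn (x i) * sgn (y i)) ^ 2 = (n : ℝ) := by
    have : ∀ i, (sgn (x i) * sgn (y i)) ^ 2 = 1 := fun i => by
      rw [sq, mul_mul_mul_comm, sgn_mul_self, sgn_mul_self, one_mul]
    simp [this]
  rw [h1] at h
  rw [sum_vertexPair fun e => edgeSgn x e * edgeSgn y e]
  simp only [edgeSgn_mk, corr]
  rw [← h, Finset.sum_congr rfl fun (e : Fin n × Fin n) _ =>
    mul_mul_mul_comm (sgn (x e.1)) (sgn (x e.2)) (sgn (y e.1)) (sgn (y e.2))]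
  ring

lemma card_vertexPair (n : ℕ) : (Fintype.card (VertexPair n) : ℝ) = n * (n - 1) / 2 := by
  have h := two_mul_sum_lt fun _ : Fin n => (1 : ℝ)
  have h2 := sum_vertexPair (n := n) fun _ => 1
  simp only [mul_one, one_pow, Finset.sum_const (1 : ℝ), Finset.card_univ, nsmul_eq_mul,
    Fintype.card_fin] at h h2
  rw [h2]
  linarith

lemma one_add_le_exp_cubic {q : ℝ} (h0 : 0 ≤ q) (h1 : q ≤ 1 / 2) :
    1 + q ≤ Real.exp (q - q ^ 2 / 2 + q ^ 3) := by
  have hu : 0 ≤ q - q ^ 2 / 2 + q ^ 3 := by nlinarith [pow_nonneg h0 3]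
  refine le_trans ?_ (Real.quadratic_le_exp_of_nonneg hu)
  have h3 := pow_nonneg h0 3
  have h4 := pow_nonneg h0 4
  have h5 := pow_nonneg h0 5
  have h6 : 0 ≤ 1 / 2 - q := by linarith
  nlinarith [mul_nonneg h3 h6, mul_nonneg h4 h6, mul_nonneg h5 h6, pow_nonneg h0 6]

lemma one_sub_le_exp_cubic {q : ℝ} (h0 : 0 ≤ q) (h1 : q ≤ 1 / 2) :
    1 - q ≤ Real.exp (-q - q ^ 2 / 2 + q ^ 3) := by
  have hx : |q| < 1 := by rw [abs_of_nonneg h0]; linarith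
  have h := sum_le_hasSum (Finset.range 2) (fun i _ => by positivity)
    (Real.hasSum_pow_div_log_of_abs_lt_one hx)
  norm_num [Finset.sum_range_succ] at h
  rw [← Real.log_le_iff_le_exp (by linarith)]
  linarith [pow_nonneg h0 3]

/-- The term `-q²/2` must be kept: over about `n²/2` pairs it contributes `-(nq)²/4`, which later
cancels the second-order term of `(1 - nq)^(-1/2)`. -/
lemma one_add_sgn_le_exp {q ξ : ℝ} (h0 : 0 ≤ q) (h1 : q ≤ 1 / 2) (hξ : ξ * ξ = 1) :
    1 + q * ξ ≤ Real.exp (q * ξ - q ^ 2 / 2 + q ^ 3) := by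
  rcases mul_self_eq_one_iff.1 hξ with rfl | rfl
  · simpa using one_add_le_exp_cubic h0 h1
  · simpa [← sub_eq_add_neg] using one_sub_le_exp_cubic h0 h1

lemma prod_vertexPair_le {n : ℕ} {q : ℝ} (h0 : 0 ≤ q) (h1 : q ≤ 1 / 2) (x y : Fin n → ZMod 2) :
    ∏ e : VertexPair n, (1 + q * (edgeSgn x e * edgeSgn y e)) ≤
      Real.exp (q * corr x y ^ 2 / 2) *
        Real.exp (-(n * q) / 2 + n * (n - 1) / 2 * (q ^ 3 - q ^ 2 / 2)) := by
  have hξ : ∀ e : VertexPair n, (edgeSgn x e * edgeSgn y e) * (edgeSgn x e * edgeSgn y e) = 1 :=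
    fun e => by rw [mul_mul_mul_comm, edgeSgn_mul_self, edgeSgn_mul_self, one_mul]
  calc ∏ e : VertexPair n, (1 + q * (edgeSgn x e * edgeSgn y e))
      ≤ ∏ e : VertexPair n, Real.exp (q * (edgeSgn x e * edgeSgn y e) - q ^ 2 / 2 + q ^ 3) := by
        refine Finset.prod_le_prod (fun e _ => ?_) fun e _ => one_add_sgn_le_exp h0 h1 (hξ e)
        rcases mul_self_eq_one_iff.1 (hξ e) with h | h <;> rw [h] <;> linarith
    _ = _ := by
        rw [← Real.exp_sum, ← Real.exp_add]
        congr 1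
        rw [Finset.sum_add_distrib, Finset.sum_sub_distrib, ← Finset.mul_sum, sum_edgeSgn]
        simp only [Finset.sum_const, Finset.card_univ, nsmul_eq_mul, card_vertexPair]
        ring

/-! ### Edge sets of random graphs -/

lemma pow_add_mul_pow_le (m k : ℕ) : m ^ (k + 1) + (k + 1) * m ^ k ≤ (m + 1) ^ (k + 1) := by
  induction k with
  | zero => simp
  | succ k ih =>
    calc m ^ (k + 2) + (k + 2) * m ^ (k + 1)
        ≤ (m ^ (k + 1) + (k + 1) * m ^ k) * (m + 1) := by
          have : 0 ≤ (k + 1) * m ^ k := Nat.zero_le _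
          nlinarith [pow_succ m (k + 1), pow_succ m k]
      _ ≤ (m + 1) ^ (k + 1) * (m + 1) := Nat.mul_le_mul_right _ ih
      _ = (m + 1) ^ (k + 2) := (pow_succ _ _).symm

/-- The number of samples whose range contains a given set. -/
lemma card_subset_range_mul_le {V : Type*} [Fintype V] [DecidableEq V] (m : ℕ) (S : Finset V) :
    (Finset.univ.filter fun s : Fin m → V => S ⊆ Finset.univ.image s).card *
        Fintype.card V ^ S.card ≤ m ^ S.card * Fintype.card V ^ m := by
  induction m generalizing S with
  | zero =>
    rcases S.eq_empty_or_nonempty with rfl | hS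
    · simp
    · simp [hS.ne_empty]
  | succ m ih =>
    set N := Fintype.card V with hN
    -- Conditioning on the first sample `v`: the remaining samples must cover `S.erase v`.
    have hsplit : (Finset.univ.filter fun s : Fin (m + 1) → V =>
          S ⊆ Finset.univ.image s).card =
        ∑ v : V, (Finset.univ.filter fun s : Fin m → V =>
          S.erase v ⊆ Finset.univ.image s).card := by
      simp only [Finset.card_filter]
      rw [← (Fin.consEquiv fun _ : Fin (m + 1) => V).sum_comp, Fintype.sum_prod_type]
      refine Finset.sum_congr rfl fun v _ => Finset.sum_congr rfl fun s _ => ?_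
      have : S ⊆ Finset.univ.image (Fin.consEquiv (fun _ : Fin (m + 1) => V) (v, s)) ↔
          S.erase v ⊆ Finset.univ.image s := by
        simp only [Finset.subset_iff, Finset.mem_image, Finset.mem_univ, true_and,
          Finset.mem_erase, Fin.exists_fin_succ, Fin.consEquiv, Equiv.coe_fn_mk, Fin.cons_zero,
          Fin.cons_succ]
        refine forall_congr' fun w => ?_
        tauto
      simp only [this]
    rcases S.eq_empty_or_nonempty with rfl | hS
    · simp [hN]
    obtain ⟨k, hk⟩ : ∃ k, S.card = k + 1 := ⟨S.card - 1, by have := hS.card_pos; omega⟩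
    rw [hsplit, hk, Finset.sum_mul]
    have hpt : ∀ v : V, (Finset.univ.filter fun s : Fin m → V =>
        S.erase v ⊆ Finset.univ.image s).card * N ^ (k + 1) ≤
        m ^ (k + 1) * N ^ m + if v ∈ S then m ^ k * N ^ (m + 1) else 0 := by
      intro v
      split_ifs with hv
      · have := ih (S.erase v)
        rw [Finset.card_erase_of_mem hv, hk, Nat.add_sub_cancel] at this
        calc _ = (Finset.univ.filter fun s : Fin m → V =>
              S.erase v ⊆ Finset.univ.image s).card * N ^ k * N := by ring
          _ ≤ m ^ k * N ^ m * N := Nat.mul_le_mul_right _ this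
          _ = m ^ k * N ^ (m + 1) := by ring
          _ ≤ _ := Nat.le_add_left _ _
      · have := ih S
        rw [hk] at this
        rwa [Finset.erase_eq_of_notMem hv, add_zero]
    refine (Finset.sum_le_sum fun v _ => hpt v).trans ?_
    rw [Finset.sum_add_distrib, Finset.sum_const, Finset.card_univ, ← hN, ← Finset.sum_filter,
      Finset.filter_mem_eq_inter, Finset.univ_inter, Finset.sum_const, hk]
    calc N • (m ^ (k + 1) * N ^ m) + (k + 1) • (m ^ k * N ^ (m + 1))
        = (m ^ (k + 1) + (k + 1) * m ^ k) * N ^ (m + 1) := by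
          simp only [smul_eq_mul]; ring
      _ ≤ _ := Nat.mul_le_mul_right _ (pow_add_mul_pow_le m k)

/-- Averaging a polynomial with nonnegative coefficients in the edges of a random sample. -/
lemma sum_sum_powerset_image_le {V : Type*} [Fintype V] [DecidableEq V] [Nonempty V] {m : ℕ}
    {r q : ℝ} (hr : 0 ≤ r) (hq : r * m ≤ q * Fintype.card V) (c : Finset V → ℝ)
    (hc : ∀ S, 0 ≤ c S) :
    ∑ s : Fin m → V, ∑ S ∈ (Finset.univ.image s).powerset, r ^ S.card * c S ≤
      Fintype.card (Fin m → V) * ∑ S, q ^ S.card * c S := by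
  have hN : (0 : ℝ) < Fintype.card V := by exact_mod_cast Fintype.card_pos
  have h1 : ∀ s : Fin m → V, ∑ S ∈ (Finset.univ.image s).powerset, r ^ S.card * c S =
      ∑ S, if S ⊆ Finset.univ.image s then r ^ S.card * c S else 0 := by
    intro s
    rw [← Finset.sum_filter]
    refine Finset.sum_congr ?_ fun _ _ => rfl
    ext S; simp
  rw [Finset.sum_congr rfl fun s _ => h1 s, Finset.sum_comm, Finset.mul_sum]
  refine Finset.sum_le_sum fun S _ => ?_
  rw [← Finset.sum_filter, Finset.sum_const, nsmul_eq_mul]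
  have hcard : ((Finset.univ.filter fun s : Fin m → V => S ⊆ Finset.univ.image s).card : ℝ) *
      (Fintype.card V : ℝ) ^ S.card ≤ (m : ℝ) ^ S.card * (Fintype.card V : ℝ) ^ m := by
    exact_mod_cast card_subset_range_mul_le m S
  set a : ℝ := ((Finset.univ.filter fun s : Fin m → V => S ⊆ Finset.univ.image s).card : ℝ)
  rw [← mul_assoc, ← mul_assoc]
  refine mul_le_mul_of_nonneg_right ?_ (hc S)
  have hV : (Fintype.card (Fin m → V) : ℝ) = (Fintype.card V : ℝ) ^ m := by
    simp
  rw [hV]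
  refine le_of_mul_le_mul_right ?_ (pow_pos hN S.card)
  calc a * r ^ S.card * (Fintype.card V : ℝ) ^ S.card
      = a * (Fintype.card V : ℝ) ^ S.card * r ^ S.card := by ring
    _ ≤ (m : ℝ) ^ S.card * (Fintype.card V : ℝ) ^ m * r ^ S.card := by gcongr
    _ = (Fintype.card V : ℝ) ^ m * (r * m) ^ S.card := by rw [mul_pow]; ring
    _ ≤ (Fintype.card V : ℝ) ^ m * (q * Fintype.card V) ^ S.card := by gcongr
    _ = _ := by rw [mul_pow]; ring

/-! ### The distinguishing advantage for a fixed graph -/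

lemma sum_prod_coord {E : Type*} [Fintype E] [DecidableEq E] (f : E → ZMod 2 → ℝ) :
    ∑ w : E → ZMod 2, ∏ e, f e (w e) = ∏ e, (f e 0 + f e 1) := by
  have h := Finset.prod_univ_sum (fun _ : E => (Finset.univ : Finset (ZMod 2))) f
  rw [Fintype.piFinset_univ] at h
  rw [← h]
  exact Finset.prod_congr rfl fun e _ => sum_zmod_two _

/-- The difference of the probabilities that Bob accepts in the two cases. -/
noncomputable def acceptGap {E : Type*} [Fintype E] [DecidableEq E] (ρ : ℝ) (d : (E → ZMod 2) → ℝ)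
    (b : E → ZMod 2) : ℝ :=
  ∑ Δ, noiseProb ρ Δ * d (b + Δ) - (∑ w, d w) / Fintype.card (E → ZMod 2)

lemma noiseProb_eq {E : Type*} [Fintype E] (ρ : ℝ) (Δ : E → ZMod 2) :
    noiseProb ρ Δ = ∏ e, (1 / 2 - ρ * sgn (Δ e)) := by
  refine Finset.prod_congr rfl fun e _ => ?_
  rcases zmod_two_cases (Δ e) with h | h <;> simp [h]

lemma noiseProb_nonneg {E : Type*} [Fintype E] {ρ : ℝ} (h0 : 0 ≤ ρ) (h1 : ρ ≤ 1 / 2)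
    (Δ : E → ZMod 2) : 0 ≤ noiseProb ρ Δ := by
  refine Finset.prod_nonneg fun e _ => ?_
  split_ifs <;> linarith

lemma sum_noiseProb {E : Type*} [Fintype E] [DecidableEq E] (ρ : ℝ) :
    ∑ Δ : E → ZMod 2, noiseProb ρ Δ = 1 := by
  simp only [noiseProb_eq]
  rw [sum_prod_coord fun _ a => 1 / 2 - ρ * sgn a]
  simp
  norm_num

lemma acceptGap_le_one {E : Type*} [Fintype E] [DecidableEq E] {ρ : ℝ} (h0 : 0 ≤ ρ)
    (h1 : ρ ≤ 1 / 2) {d : (E → ZMod 2) → ℝ} (hd0 : ∀ w, 0 ≤ d w) (hd1 : ∀ w, d w ≤ 1)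
    (b : E → ZMod 2) : acceptGap ρ d b ≤ 1 := by
  have h2 : ∑ Δ, noiseProb ρ Δ * d (b + Δ) ≤ ∑ Δ : E → ZMod 2, noiseProb ρ Δ :=
    Finset.sum_le_sum fun Δ _ => mul_le_of_le_one_right (noiseProb_nonneg h0 h1 Δ) (hd1 _)
  have h3 : 0 ≤ (∑ w, d w) / Fintype.card (E → ZMod 2) :=
    div_nonneg (Finset.sum_nonneg fun w _ => hd0 w) (Nat.cast_nonneg _)
  rw [sum_noiseProb] at h2
  unfold acceptGap
  linarith

/-- Relative to the uniform law, each noise coordinate has density `1 - 2ρ sgn`. In the product of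
two shifted densities the linear terms average to zero, and the quadratic term gives `4ρ²`. -/
lemma sum_noiseProb_mul_noiseProb {E : Type*} [Fintype E] [DecidableEq E] (ρ : ℝ)
    (b b' : E → ZMod 2) :
    Fintype.card (E → ZMod 2) * ∑ w, noiseProb ρ (w - b) * noiseProb ρ (w - b') =
      ∏ e, (1 + 4 * ρ ^ 2 * (sgn (b e) * sgn (b' e))) := by
  have hK : (Fintype.card (E → ZMod 2) : ℝ) = ∏ _e : E, 2 := by simp
  simp only [noiseProb_eq, ← Finset.prod_mul_distrib, Pi.sub_apply]
  rw [sum_prod_coord fun e a => (1 / 2 - ρ * sgn (a - b e)) * (1 / 2 - ρ * sgn (a - b' e)), hK,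
    ← Finset.prod_mul_distrib]
  refine Finset.prod_congr rfl fun e _ => ?_
  simp only [ZModModule.sub_eq_add, sgn_add, sgn_zero, sgn_one]
  ring

/-- The sum is the inner product of `d` with `h`, the excess of the mixed label law over uniform.
Cauchy–Schwarz with `0 ≤ d ≤ 1` leaves the second moment of `h`, that is, a chi-square distance. -/
lemma sq_sum_acceptGap_le {E X : Type*} [Fintype E] [DecidableEq E] (ρ : ℝ)
    {d : (E → ZMod 2) → ℝ} (hd0 : ∀ w, 0 ≤ d w) (hd1 : ∀ w, d w ≤ 1)
    (A : Finset X) (b : X → E → ZMod 2) :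
    (∑ x ∈ A, acceptGap ρ d (b x)) ^ 2 ≤
      ∑ x ∈ A, ∑ y ∈ A, ∏ e, (1 + 4 * ρ ^ 2 * (sgn (b x e) * sgn (b y e))) - (A.card : ℝ) ^ 2 := by
  set K : ℝ := (Fintype.card (E → ZMod 2) : ℝ) with hK
  have hKpos : 0 < K := by rw [hK]; exact_mod_cast Fintype.card_pos
  have hshift : ∀ x, ∑ Δ, noiseProb ρ Δ * d (b x + Δ) = ∑ w, noiseProb ρ (w - b x) * d w := by
    intro x
    rw [← Equiv.sum_comp (Equiv.addLeft (b x)) fun w => noiseProb ρ (w - b x) * d w]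
    simp
  set h : (E → ZMod 2) → ℝ := fun w => ∑ x ∈ A, noiseProb ρ (w - b x) - A.card / K with hh
  have hsum : ∑ x ∈ A, acceptGap ρ d (b x) = ∑ w, h w * d w := by
    simp only [acceptGap, hshift, hh, sub_mul, Finset.sum_sub_distrib, Finset.sum_mul]
    rw [Finset.sum_comm, Finset.sum_const, nsmul_eq_mul, ← Finset.mul_sum]
    ring
  have htot : ∑ w, ∑ x ∈ A, noiseProb ρ (w - b x) = (A.card : ℝ) := by
    rw [Finset.sum_comm]
    have : ∀ x ∈ A, ∑ w, noiseProb ρ (w - b x) = 1 := fun x _ =>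
      (Equiv.sum_comp (Equiv.subRight (b x)) (noiseProb ρ)).trans (sum_noiseProb ρ)
    rw [Finset.sum_congr rfl this]
    simp
  have hsq : K * ∑ w, h w ^ 2 =
      ∑ x ∈ A, ∑ y ∈ A, ∏ e, (1 + 4 * ρ ^ 2 * (sgn (b x e) * sgn (b y e))) -
        (A.card : ℝ) ^ 2 := by
    have h1 : ∑ w, h w ^ 2 = ∑ w, (∑ x ∈ A, noiseProb ρ (w - b x)) ^ 2 - (A.card : ℝ) ^ 2 / K := by
      simp only [hh, sub_sq, Finset.sum_add_distrib, Finset.sum_sub_distrib, ← Finset.sum_mul,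
        ← Finset.mul_sum, htot, Finset.sum_const, Finset.card_univ, nsmul_eq_mul, ← hK]
      field_simp
      ring
    rw [h1, mul_sub, mul_div_cancel₀ _ hKpos.ne']
    congr 1
    simp only [sq (∑ x ∈ A, noiseProb ρ (_ - b x)), Finset.sum_mul_sum]
    rw [Finset.sum_comm, Finset.mul_sum]
    refine Finset.sum_congr rfl fun x _ => ?_
    rw [Finset.sum_comm, Finset.mul_sum]
    exact Finset.sum_congr rfl fun y _ => sum_noiseProb_mul_noiseProb ρ (b x) (b y)
  have hd : ∑ w, d w ^ 2 ≤ K := by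
    calc ∑ w, d w ^ 2 ≤ ∑ _w : E → ZMod 2, (1 : ℝ) :=
          Finset.sum_le_sum fun w _ => pow_le_one₀ (hd0 w) (hd1 w)
      _ = K := by simp [hK]
  rw [hsum, ← hsq]
  calc (∑ w, h w * d w) ^ 2 ≤ (∑ w, h w ^ 2) * ∑ w, d w ^ 2 :=
        Finset.sum_mul_sq_le_sq_mul_sq _ _ _
    _ ≤ (∑ w, h w ^ 2) * K :=
        mul_le_mul_of_nonneg_left hd (Finset.sum_nonneg fun _ _ => sq_nonneg _)
    _ = _ := mul_comm _ _

/-! ### The distinguishing advantage for the random graph -/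

lemma mem_edgeSet_unionGraph {n m : ℕ} (s : Fin m → VertexPair n) (e : Sym2 (Fin n)) :
    e ∈ (unionGraph s).edgeSet ↔ ∃ i, (s i : Sym2 (Fin n)) = e := by
  simp only [unionGraph, SimpleGraph.edgeSet_fromEdgeSet, Set.mem_sdiff, Set.mem_range]
  constructor
  · exact fun h => h.1
  · rintro ⟨i, rfl⟩
    exact ⟨⟨i, rfl⟩, (s i).2⟩

open scoped Classical in
lemma sgn_mulVec {n : ℕ} (G : SimpleGraph (Fin n)) (x : Fin n → ZMod 2) (e : G.edgeSet) :
    sgn ((edgeVertexMatrix G).mulVec x e) = edgeSgn x e := by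
  obtain ⟨e, he⟩ := e
  induction e with
  | _ u v =>
    have huv : u ≠ v := G.ne_of_adj he
    have h : (edgeVertexMatrix G).mulVec x ⟨s(u, v), he⟩ = x u + x v := by
      simp only [Matrix.mulVec, dotProduct, edgeVertexMatrix, Matrix.of_apply,
        SimpleGraph.incMatrix_apply']
      have : ∀ i, (if s(u, v) ∈ G.incidenceSet i then (1 : ZMod 2) else 0) * x i =
          (if i = u then x i else 0) + if i = v then x i else 0 := by
        intro i
        have hmem : s(u, v) ∈ G.incidenceSet i ↔ i = u ∨ i = v := by
          exact ⟨fun h => Sym2.mem_iff.1 h.2, fun h => ⟨he, Sym2.mem_iff.2 h⟩⟩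
        by_cases hu : i = u
        · have hv : i ≠ v := fun hv => huv (hu.symm.trans hv)
          rw [if_pos (hmem.2 (Or.inl hu)), if_pos hu, if_neg hv, one_mul, add_zero]
        · simp [hmem, hu]
      rw [Fintype.sum_congr _ _ this, Finset.sum_add_distrib]
      simp
    rw [h, sgn_add, edgeSgn_mk]

open scoped Classical in
lemma prod_edgeSet_eq {n m : ℕ} (s : Fin m → VertexPair n) (F : Sym2 (Fin n) → ℝ) :
    ∏ e : (unionGraph s).edgeSet, F e = ∏ e ∈ Finset.univ.image s, F e := by
  refine Finset.prod_bij' (fun e _ => ⟨e.1, (unionGraph s).not_isDiag_of_mem_edgeSet e.2⟩)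
    (fun e he => ⟨e.1, (mem_edgeSet_unionGraph s _).2 ?_⟩) ?_ ?_ ?_ ?_ ?_
  · obtain ⟨i, _, hi⟩ := Finset.mem_image.1 he
    exact ⟨i, by rw [hi]⟩
  · intro e _
    obtain ⟨i, hi⟩ := (mem_edgeSet_unionGraph s _).1 e.2
    exact Finset.mem_image.2 ⟨i, Finset.mem_univ _, Subtype.ext hi⟩
  · simp
  · simp
  · simp
  · simp

open scoped Classical in
/-- The acceptance gap on the sample `s`, for Bob's decision rule `d`. -/
noncomputable def sampleGap {n m : ℕ} (ρ : ℝ)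
    (d : (G : SimpleGraph (Fin n)) → (G.edgeSet → ZMod 2) → ℝ) (s : Fin m → VertexPair n)
    (x : Fin n → ZMod 2) : ℝ :=
  acceptGap ρ (d (unionGraph s)) ((edgeVertexMatrix (unionGraph s)).mulVec x)

open scoped Classical in
-- Cauchy–Schwarz over samples, then Fourier expansion in edge sets. The coefficients are squares,
-- so the containment bound applies termwise, and the series resums to a product over all pairs with
-- `q ≥ 4ρ²m/N`.
lemma sq_sum_sampleGap_le {n m : ℕ} {ρ q : ℝ} (hn : 2 ≤ n)
    (hq : 4 * ρ ^ 2 * m ≤ q * (n * (n - 1) / 2))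
    {d : (G : SimpleGraph (Fin n)) → (G.edgeSet → ZMod 2) → ℝ} (hd0 : ∀ G w, 0 ≤ d G w)
    (hd1 : ∀ G w, d G w ≤ 1) (A : Finset (Fin n → ZMod 2)) :
    (∑ s : Fin m → VertexPair n, ∑ x ∈ A, sampleGap ρ d s x) ^ 2 ≤
      (Fintype.card (Fin m → VertexPair n) : ℝ) ^ 2 *
        (∑ x ∈ A, ∑ y ∈ A, ∏ e : VertexPair n, (1 + q * (edgeSgn x e * edgeSgn y e)) -
          (A.card : ℝ) ^ 2) := by
  set Q : ℝ := (Fintype.card (Fin m → VertexPair n) : ℝ) with hQ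
  have hne : Nonempty (VertexPair n) :=
    ⟨⟨s(⟨0, by omega⟩, ⟨1, by omega⟩), by simp⟩⟩
  have hgap : ∀ s : Fin m → VertexPair n, (∑ x ∈ A, sampleGap ρ d s x) ^ 2 ≤
      ∑ S ∈ (Finset.univ.image s).powerset, (4 * ρ ^ 2) ^ S.card *
        (∑ x ∈ A, ∏ e ∈ S, edgeSgn x (e : VertexPair n)) ^ 2 - (A.card : ℝ) ^ 2 := by
    intro s
    refine (sq_sum_acceptGap_le ρ (hd0 _) (hd1 _) A _).trans (le_of_eq ?_)
    congr 1
    rw [← sum_prod_one_add A _ (fun x (e : VertexPair n) => edgeSgn x e)]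
    refine Finset.sum_congr rfl fun x _ => Finset.sum_congr rfl fun y _ => ?_
    simp only [sgn_mulVec]
    exact prod_edgeSet_eq s fun e => 1 + 4 * ρ ^ 2 * (edgeSgn x e * edgeSgn y e)
  have havg := sum_sum_powerset_image_le (m := m) (by positivity : 0 ≤ 4 * ρ ^ 2)
    (by rw [card_vertexPair]; exact hq)
    (fun S : Finset (VertexPair n) => (∑ x ∈ A, ∏ e ∈ S, edgeSgn x e) ^ 2)
    fun S => sq_nonneg _
  have hall := sum_prod_one_add A Finset.univ (fun x (e : VertexPair n) => edgeSgn x e) q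
  rw [Finset.powerset_univ] at hall
  rw [hall]
  calc (∑ s : Fin m → VertexPair n, ∑ x ∈ A, sampleGap ρ d s x) ^ 2
      ≤ Q * ∑ s : Fin m → VertexPair n, (∑ x ∈ A, sampleGap ρ d s x) ^ 2 := by
        simpa [hQ] using sq_sum_le_card_mul_sum_sq (s := Finset.univ)
          (f := fun s : Fin m → VertexPair n => ∑ x ∈ A, sampleGap ρ d s x)
    _ ≤ Q * ∑ s : Fin m → VertexPair n, (∑ S ∈ (Finset.univ.image s).powerset,
          (4 * ρ ^ 2) ^ S.card * (∑ x ∈ A, ∏ e ∈ S, edgeSgn x (e : VertexPair n)) ^ 2 -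
            (A.card : ℝ) ^ 2) := by
        refine mul_le_mul_of_nonneg_left (Finset.sum_le_sum fun s _ => hgap s) ?_
        rw [hQ]; positivity
    _ ≤ _ := by
        rw [Finset.sum_sub_distrib, Finset.sum_const, Finset.card_univ, nsmul_eq_mul, ← hQ]
        rw [← hQ] at havg
        have hQ0 : 0 ≤ Q := by rw [hQ]; positivity
        have := mul_le_mul_of_nonneg_left havg hQ0
        refine le_of_sub_nonneg ?_
        linarith

/-! ### The advantage of a protocol -/

lemma inv_sqrt_one_sub_le {t : ℝ} (h0 : 0 ≤ t) (h1 : t ≤ 1 / 10) :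
    (√(1 - t))⁻¹ ≤ Real.exp (t / 2 + t ^ 2 / 4 + t ^ 3) := by
  have hx : |t| < 1 := by rw [abs_of_nonneg h0]; linarith
  have h := Real.abs_log_sub_add_sum_range_le hx 2
  rw [abs_of_nonneg h0] at h
  have h2 := (abs_le.1 h).1
  have h3 : t ^ 3 / (1 - t) ≤ 2 * t ^ 3 := by
    rw [div_le_iff₀ (by linarith)]
    nlinarith [pow_nonneg h0 3]
  norm_num [Finset.sum_range_succ] at h2
  have hpos : 0 < 1 - t := by linarith
  have h4 : Real.exp (-(t + t ^ 2 / 2 + 2 * t ^ 3)) ≤ 1 - t := by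
    rw [← Real.le_log_iff_exp_le hpos]
    linarith
  rw [← Real.sqrt_inv, Real.sqrt_le_left (Real.exp_pos _).le, ← Real.exp_nat_mul]
  have h5 := inv_anti₀ (Real.exp_pos _) h4
  rw [← Real.exp_neg, neg_neg] at h5
  refine h5.trans (Real.exp_le_exp.2 (le_of_eq ?_))
  push_cast; ring

lemma exp_le_one_add_two_mul {x : ℝ} (h0 : 0 ≤ x) (h1 : x ≤ 1 / 2) : Real.exp x ≤ 1 + 2 * x := by
  have h := Real.add_one_le_exp (-x)
  rw [Real.exp_neg] at h
  have hp := Real.exp_pos x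
  have h' := mul_le_mul_of_nonneg_right h hp.le
  rw [inv_mul_cancel₀ hp.ne'] at h'
  nlinarith

/-- The exponent `E` is at most `-t/2 - t²/4 + tq`, while `(1 - t)^(-1/2) ≤ exp (t/2 + t²/4 + t³)`.
The first two orders cancel, leaving `t³ + tq`. -/
lemma sum_prod_vertexPair_le {n : ℕ} {L q : ℝ} (hq : 0 ≤ q) (hq1 : q ≤ 1 / 10)
    (hnq : n * q ≤ 1 / 10) (hL : 1 ≤ L) (hqL : √q * L ≤ 1 / 20)
    (A : Finset (Fin n → ZMod 2)) (hA : 2 ^ n * Real.exp (-L) ≤ (A.card : ℝ)) :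
    ∑ x ∈ A, ∑ y ∈ A, ∏ e : VertexPair n, (1 + q * (edgeSgn x e * edgeSgn y e)) -
        (A.card : ℝ) ^ 2 ≤
      (A.card : ℝ) ^ 2 * (2 * ((n * q) ^ 3 + n * q * q) + 160 * (q * L ^ 2)) := by
  set t : ℝ := n * q with ht
  have ht0 : 0 ≤ t := by positivity
  set E : ℝ := -t / 2 + n * (n - 1) / 2 * (q ^ 3 - q ^ 2 / 2) with hE
  have hE1 : E ≤ -(t / 2) - t ^ 2 / 4 + t * q := by
    have e1 : E = -(t / 2) - t ^ 2 / 4 + t * q / 4 + t ^ 2 * q / 2 - t * q ^ 2 / 2 := by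
      rw [hE, ht]; ring
    have e2 : t ^ 2 * q ≤ t * q := by
      rw [sq]; gcongr; exact mul_le_of_le_one_left ht0 (by linarith)
    have e3 : 0 ≤ t * q := by positivity
    have e4 : 0 ≤ t * q ^ 2 := by positivity
    linarith
  have hE2 : E ≤ 0 := by
    have : t * q ≤ t * (1 / 2) := by gcongr; linarith
    linarith [sq_nonneg t]
  have hsum : ∑ x ∈ A, ∑ y ∈ A, ∏ e : VertexPair n, (1 + q * (edgeSgn x e * edgeSgn y e)) ≤
      (∑ x ∈ A, ∑ y ∈ A, Real.exp (q * corr x y ^ 2 / 2)) * Real.exp E := by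
    rw [Finset.sum_mul]
    refine Finset.sum_le_sum fun x _ => ?_
    rw [Finset.sum_mul]
    exact Finset.sum_le_sum fun y _ => prod_vertexPair_le hq (by linarith) x y
  have hG := sum_exp_corr_sq_le hq hnq hL hqL A hA
  rw [← ht] at hG
  have hmain : (√(1 - t))⁻¹ * Real.exp E ≤ 1 + 2 * (t ^ 3 + t * q) := by
    have hsmall : t ^ 3 + t * q ≤ 1 / 2 := by
      have a1 : t ^ 3 ≤ (1 / 10) ^ 3 := by gcongr
      have a2 : t * q ≤ 1 / 10 * (1 / 10) := by gcongr
      linarith [(by norm_num : ((1 : ℝ) / 10) ^ 3 = 1 / 1000)]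
    refine le_trans ?_ (exp_le_one_add_two_mul (by positivity) hsmall)
    calc _ ≤ Real.exp (t / 2 + t ^ 2 / 4 + t ^ 3) * Real.exp E := by
          gcongr; exact inv_sqrt_one_sub_le ht0 hnq
      _ = Real.exp (t / 2 + t ^ 2 / 4 + t ^ 3 + E) := (Real.exp_add _ _).symm
      _ ≤ _ := Real.exp_le_exp.2 (by linarith)
  have hrest : 160 * (q * L ^ 2) * Real.exp E ≤ 160 * (q * L ^ 2) :=
    mul_le_of_le_one_right (by positivity) (Real.exp_le_one_iff.2 hE2)
  have hP : 0 ≤ (A.card : ℝ) ^ 2 := by positivity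
  calc _ ≤ (A.card : ℝ) ^ 2 * ((√(1 - t))⁻¹ + 160 * (q * L ^ 2)) * Real.exp E -
        (A.card : ℝ) ^ 2 :=
        sub_le_sub_right (hsum.trans (mul_le_mul_of_nonneg_right hG (Real.exp_pos _).le)) _
    _ = (A.card : ℝ) ^ 2 *
        ((√(1 - t))⁻¹ * Real.exp E + 160 * (q * L ^ 2) * Real.exp E - 1) := by ring
    _ ≤ _ := mul_le_mul_of_nonneg_left (by linarith) hP

namespace Protocol

variable {n : ℕ}

/-- Bob's decision rule on the message `a`, as an indicator. -/
def accepts (P : Protocol n) (a : List Bool) (G : SimpleGraph (Fin n))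
    (w : G.edgeSet → ZMod 2) : ℝ :=
  if P.answer a G w = true then 1 else 0

lemma accepts_nonneg (P : Protocol n) (a : List Bool) (G : SimpleGraph (Fin n))
    (w : G.edgeSet → ZMod 2) : 0 ≤ P.accepts a G w := by
  unfold accepts; split_ifs <;> norm_num

lemma accepts_le_one (P : Protocol n) (a : List Bool) (G : SimpleGraph (Fin n))
    (w : G.edgeSet → ZMod 2) : P.accepts a G w ≤ 1 := by
  unfold accepts; split_ifs <;> norm_num

open scoped Classical in
lemma advantage_eq (P : Protocol n) (hn : 2 ≤ n) (m : ℕ) (ρ : ℝ) :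
    P.advantage m ρ = 1 / 2 * ((∑ x, ∑ s : Fin m → VertexPair n,
      sampleGap ρ (P.accepts (P.message x)) s x) /
        (2 ^ n * Fintype.card (Fin m → VertexPair n))) := by
  have hne : Nonempty (VertexPair n) :=
    ⟨⟨s(⟨0, by omega⟩, ⟨1, by omega⟩), by simp⟩⟩
  have hno : ∀ (x : Fin n → ZMod 2) (s : Fin m → VertexPair n),
      (𝔼 w : (unionGraph s).edgeSet → ZMod 2,
        (if P.answer (P.message x) (unionGraph s) w = false then (1 : ℝ) else 0)) =
      1 - (∑ w, P.accepts (P.message x) (unionGraph s) w) /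
        Fintype.card ((unionGraph s).edgeSet → ZMod 2) := by
    intro x s
    have h1 : ∀ w : (unionGraph s).edgeSet → ZMod 2,
        (if P.answer (P.message x) (unionGraph s) w = false then (1 : ℝ) else 0) =
          1 - P.accepts (P.message x) (unionGraph s) w := by
      intro w
      unfold accepts
      cases P.answer (P.message x) (unionGraph s) w <;> simp
    simp only [h1, Finset.expect_sub_distrib, Finset.expect_const Finset.univ_nonempty]
    rw [Finset.expect_eq_sum_div_card, Finset.card_univ]
  have hgap : P.yesCorrectProb m ρ + P.noCorrectProb m - 1 =
      𝔼 x : Fin n → ZMod 2, 𝔼 s : Fin m → VertexPair n,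
        sampleGap ρ (P.accepts (P.message x)) s x := by
    simp only [yesCorrectProb, noCorrectProb, hno, Finset.expect_sub_distrib,
      Finset.expect_const Finset.univ_nonempty, sampleGap, acceptGap]
    simp only [accepts]
    ring
  have : P.advantage m ρ = 1 / 2 * (P.yesCorrectProb m ρ + P.noCorrectProb m - 1) := by
    unfold advantage; ring
  rw [this, hgap]
  simp only [Finset.expect_eq_sum_div_card, ← Finset.sum_div, Finset.card_univ]
  rw [div_div, mul_comm (Fintype.card _ : ℝ)]
  simp

open scoped Classical in
-- Messages may have different lengths; padding with `none` encodes them as words of length `k` over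
-- three symbols. This crude count suffices.
lemma card_image_message_le (P : Protocol n) {k : ℕ} (hP : ∀ x, (P.message x).length ≤ k) :
    (Finset.univ.image P.message).card ≤ 3 ^ k := by
  have h := Finset.card_le_card_of_injOn (s := Finset.univ.image P.message)
    (t := (Finset.univ : Finset (Fin k → Option Bool))) (fun l i => l[(i : ℕ)]?)
    (fun _ _ => Finset.mem_coe.2 (Finset.mem_univ _)) ?_
  · simpa using h
  · intro l hl l' hl' hll
    obtain ⟨x, _, rfl⟩ := Finset.mem_image.1 (Finset.mem_coe.1 hl)
    obtain ⟨y, _, rfl⟩ := Finset.mem_image.1 (Finset.mem_coe.1 hl')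
    refine List.ext_getElem? fun i => ?_
    by_cases hi : i < k
    · exact congrFun hll ⟨i, hi⟩
    · rw [List.getElem?_eq_none (by linarith [hP x]), List.getElem?_eq_none (by linarith [hP y])]

open scoped Classical in
-- A fiber of density at least `exp (-L)` is handled by the chi-square bound. A smaller one
-- contributes at most its own size, since each gap is at most `1`.
lemma sum_fiber_sampleGap_le (P : Protocol n) (hn : 2 ≤ n) {m : ℕ} {ρ q L : ℝ}
    (hρ0 : 0 ≤ ρ) (hρ1 : ρ ≤ 1 / 2) (hm : 4 * ρ ^ 2 * m ≤ q * (n * (n - 1) / 2))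
    (hq : 0 ≤ q) (hq1 : q ≤ 1 / 10) (hnq : n * q ≤ 1 / 10) (hL : 1 ≤ L) (hqL : √q * L ≤ 1 / 20)
    (a : List Bool) (A : Finset (Fin n → ZMod 2)) :
    ∑ s : Fin m → VertexPair n, ∑ x ∈ A, sampleGap ρ (P.accepts a) s x ≤
      Fintype.card (Fin m → VertexPair n) *
        (A.card * √(2 * ((n * q) ^ 3 + n * q * q) + 160 * (q * L ^ 2)) +
          2 ^ n * Real.exp (-L)) := by
  set Q : ℝ := (Fintype.card (Fin m → VertexPair n) : ℝ) with hQ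
  have hQ0 : 0 ≤ Q := by rw [hQ]; positivity
  set X : ℝ := 2 * ((n * q) ^ 3 + n * q * q) + 160 * (q * L ^ 2) with hX
  have hX0 : 0 ≤ X := by positivity
  by_cases hA : 2 ^ n * Real.exp (-L) ≤ (A.card : ℝ)
  · have h := (sq_sum_sampleGap_le hn hm (P.accepts_nonneg a) (P.accepts_le_one a) A).trans
      (mul_le_mul_of_nonneg_left (sum_prod_vertexPair_le hq hq1 hnq hL hqL A hA) (sq_nonneg _))
    rw [← hQ, ← hX] at h
    have e : Q ^ 2 * ((A.card : ℝ) ^ 2 * X) = (Q * (A.card * √X)) ^ 2 := by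
      rw [mul_pow, mul_pow, Real.sq_sqrt hX0]
    rw [e] at h
    refine (abs_le_of_sq_le_sq' h (by positivity)).2.trans ?_
    gcongr
    exact le_add_of_nonneg_right (by positivity)
  · have h : ∑ s : Fin m → VertexPair n, ∑ x ∈ A, sampleGap ρ (P.accepts a) s x ≤
        ∑ _s : Fin m → VertexPair n, ∑ _x ∈ A, (1 : ℝ) :=
      Finset.sum_le_sum fun s _ => Finset.sum_le_sum fun x _ =>
        acceptGap_le_one hρ0 hρ1 (P.accepts_nonneg a _) (P.accepts_le_one a _) _
    refine h.trans ?_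
    rw [Finset.sum_const, Finset.sum_const, Finset.card_univ, nsmul_eq_mul, nsmul_eq_mul, mul_one,
      ← hQ]
    gcongr
    have : 0 ≤ A.card * √X := by positivity
    linarith

open scoped Classical in
-- The choice `L = 3c` beats the number of messages, at most `3^c ≤ exp (2c)`: the small fibers
-- together have density at most `exp (-c)`.
lemma advantage_le (P : Protocol n) (hn : 2 ≤ n) {m : ℕ} {ρ q c : ℝ}
    (hρ0 : 0 ≤ ρ) (hρ1 : ρ ≤ 1 / 2) (hm : 4 * ρ ^ 2 * m ≤ q * (n * (n - 1) / 2))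
    (hq : 0 ≤ q) (hq1 : q ≤ 1 / 10) (hnq : n * q ≤ 1 / 10) (hc : 1 ≤ 3 * c)
    (hqc : √q * (3 * c) ≤ 1 / 20) (hP : P.UsesAtMost c) :
    P.advantage m ρ ≤
      √(2 * ((n * q) ^ 3 + n * q * q) + 160 * (q * (3 * c) ^ 2)) + Real.exp (-c) := by
  have hne : Nonempty (VertexPair n) :=
    ⟨⟨s(⟨0, by omega⟩, ⟨1, by omega⟩), by simp⟩⟩
  set Q : ℝ := (Fintype.card (Fin m → VertexPair n) : ℝ) with hQ
  have hQ0 : 0 < Q := by rw [hQ]; exact_mod_cast Fintype.card_pos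
  set Y : ℝ := √(2 * ((n * q) ^ 3 + n * q * q) + 160 * (q * (3 * c) ^ 2)) with hY
  have hY0 : 0 ≤ Y := Real.sqrt_nonneg _
  have hc0 : 0 ≤ c := by linarith
  have hfiber : ∑ x, ∑ s : Fin m → VertexPair n, sampleGap ρ (P.accepts (P.message x)) s x ≤
      ∑ a ∈ Finset.univ.image P.message, Q *
        (((Finset.univ.filter fun x => P.message x = a).card : ℝ) * Y +
          2 ^ n * Real.exp (-(3 * c))) := by
    rw [← Finset.sum_fiberwise_of_maps_to (t := Finset.univ.image P.message) (g := P.message)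
      fun x _ => Finset.mem_image_of_mem _ (Finset.mem_univ x)]
    refine Finset.sum_le_sum fun a _ => ?_
    refine le_trans (le_of_eq ?_) (P.sum_fiber_sampleGap_le hn hρ0 hρ1 hm hq hq1 hnq hc hqc a _)
    rw [Finset.sum_comm]
    refine Finset.sum_congr rfl fun s _ => Finset.sum_congr rfl fun x hx => ?_
    rw [(Finset.mem_filter.1 hx).2]
  have hcount : (∑ a ∈ Finset.univ.image P.message,
      ((Finset.univ.filter fun x => P.message x = a).card : ℝ)) = 2 ^ n := by
    rw [← Nat.cast_sum, ← Finset.card_eq_sum_card_image]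
    simp
  have hmsg : ((Finset.univ.image P.message).card : ℝ) ≤ Real.exp (2 * c) := by
    have h := P.card_image_message_le (k := ⌊c⌋₊) fun x => Nat.le_floor (hP x)
    have h3 : (3 : ℝ) ≤ Real.exp 2 := by
      linarith [Real.add_one_le_exp (2 : ℝ)]
    calc ((Finset.univ.image P.message).card : ℝ) ≤ 3 ^ ⌊c⌋₊ := by exact_mod_cast h
      _ ≤ Real.exp 2 ^ ⌊c⌋₊ := by gcongr
      _ = Real.exp (⌊c⌋₊ * 2) := (Real.exp_nat_mul _ _).symm
      _ ≤ _ := Real.exp_le_exp.2 (by linarith [Nat.floor_le hc0])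
  have htotal : ∑ x, ∑ s : Fin m → VertexPair n, sampleGap ρ (P.accepts (P.message x)) s x ≤
      (Y + Real.exp (-c)) * (2 ^ n * Q) := by
    refine hfiber.trans ?_
    rw [← Finset.mul_sum, Finset.sum_add_distrib, ← Finset.sum_mul, hcount, Finset.sum_const,
      nsmul_eq_mul]
    have : ((Finset.univ.image P.message).card : ℝ) * (2 ^ n * Real.exp (-(3 * c))) ≤
        2 ^ n * Real.exp (-c) := by
      calc _ ≤ Real.exp (2 * c) * (2 ^ n * Real.exp (-(3 * c))) := by gcongr
        _ = 2 ^ n * (Real.exp (2 * c) * Real.exp (-(3 * c))) := by ring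
        _ = _ := by rw [← Real.exp_add]; congr 2; ring
    calc _ ≤ Q * (2 ^ n * Y + 2 ^ n * Real.exp (-c)) := by gcongr
      _ = _ := by ring
  rw [P.advantage_eq hn, ← hQ]
  have h1 := (div_le_iff₀ (by positivity : 0 < 2 ^ n * Q)).2 htotal
  have h2 : 0 ≤ Y + Real.exp (-c) := by positivity
  linarith

end Protocol

lemma Protocol.advantage_le_of_params {n : ℕ} (hn : 10 ≤ n) {ε γ α : ℝ} (hε0 : 0 < ε)
    (hε1 : ε < 0.05) (hεn : 1 / √(n : ℝ) ≤ ε) (hγ : 0 < γ) (hγn : 2 * Real.log n ≤ γ * √(n : ℝ))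
    (hγ1 : 1 ≤ γ * √(n : ℝ)) (hα0 : ε ^ 2 / n ≤ α) (hα1 : α * γ ^ 2 ≤ 1 / 10 ^ 7)
    (hα2 : α ≤ 1 / 10 ^ 4) (P : Protocol n) (hP : P.UsesAtMost (γ * √(n : ℝ))) :
    P.advantage ⌊α * n / ε ^ 2⌋₊ (10 * ε) ≤ 54001 * ((γ + α) * √α) := by
  have hnR : (10 : ℝ) ≤ n := by exact_mod_cast hn
  have hnpos : (0 : ℝ) < n := by linarith
  have hn1 : (0 : ℝ) < n - 1 := by linarith
  set c := γ * √(n : ℝ) with hc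
  have hcsq : c ^ 2 = γ ^ 2 * n := by rw [hc, mul_pow, Real.sq_sqrt hnpos.le]
  have hα : 0 < α := lt_of_lt_of_le (by positivity) hα0
  set q : ℝ := 800 * α / (n - 1) with hq
  have hq0 : 0 ≤ q := by positivity
  have hqn : n * q ≤ 900 * α := by
    rw [hq, mul_div_assoc', div_le_iff₀ hn1]
    nlinarith
  have hm : 4 * (10 * ε) ^ 2 * (⌊α * n / ε ^ 2⌋₊ : ℝ) ≤ q * (n * (n - 1) / 2) := by
    have h1 : (⌊α * n / ε ^ 2⌋₊ : ℝ) ≤ α * n / ε ^ 2 := Nat.floor_le (by positivity)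
    calc _ ≤ 4 * (10 * ε) ^ 2 * (α * n / ε ^ 2) := by gcongr
      _ = q * (n * (n - 1) / 2) := by rw [hq]; field_simp; ring
  have hnq : n * q ≤ 1 / 10 := by
    norm_num at hα2
    linarith
  have hq1 : q ≤ 1 / 10 := le_trans (le_mul_of_one_le_left hq0 (by linarith)) hnq
  have hqc2 : q * c ^ 2 ≤ 900 * (α * γ ^ 2) := by
    calc q * c ^ 2 = (n * q) * γ ^ 2 := by rw [hcsq]; ring
      _ ≤ 900 * α * γ ^ 2 := by gcongr
      _ = _ := by ring
  have hqc : √q * (3 * c) ≤ 1 / 20 := by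
    refine abs_le_of_sq_le_sq' ?_ (by norm_num) |>.2
    rw [mul_pow, Real.sq_sqrt hq0]
    norm_num at hα1 ⊢
    linarith
  refine (P.advantage_le (by omega) (by linarith) (by norm_num at hε1; linarith) hm hq0 hq1 hnq
    (by linarith) hqc hP).trans ?_
  have hsα : √α ^ 2 = α := Real.sq_sqrt hα.le
  have hsα0 : 0 ≤ √α := Real.sqrt_nonneg α
  -- The radicand is at most `2 * 900³ α³ + (2 * 900² + 160 * 9 * 900) αγ²`, and `54000²` exceeds
  -- both coefficients.
  have hmain : √(2 * ((n * q) ^ 3 + n * q * q) + 160 * (q * (3 * c) ^ 2)) ≤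
      54000 * ((γ + α) * √α) := by
    have e : (54000 * ((γ + α) * √α)) ^ 2 = 54000 ^ 2 * ((γ + α) ^ 2 * α) := by
      rw [mul_pow, mul_pow (γ + α), hsα]
    rw [Real.sqrt_le_left (by positivity), e]
    have h1 : (n * q) ^ 3 ≤ 900 ^ 3 * α ^ 3 := by
      rw [← mul_pow]; gcongr
    have h2 : n * q * q ≤ 900 ^ 2 * (α * γ ^ 2) := by
      have h3 : q ≤ 900 * γ ^ 2 := by
        have : 1 ≤ γ ^ 2 * n := by rw [← hcsq]; nlinarith
        have h4 : n * q ≤ n * (900 * γ ^ 2) := by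
          norm_num at hα2
          linarith
        exact le_of_mul_le_mul_left h4 hnpos
      calc n * q * q ≤ (900 * α) * (900 * γ ^ 2) := by gcongr
        _ = _ := by ring
    have h5 : 0 ≤ α * γ ^ 2 := by positivity
    have h6 : 0 ≤ α ^ 3 := by positivity
    have h7 : 0 ≤ α * (γ * α) := by positivity
    nlinarith
  -- Here `exp (-c) ≤ n⁻²`, while `γ ≥ n^(-1/2)` and `α ≥ ε²/n ≥ n⁻²`, so `γ√α ≥ n^(-3/2)`. This
  -- accounts for the extra `1` in `54001`.
  have hexp : Real.exp (-c) ≤ (γ + α) * √α := by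
    have hsn : 0 < √(n : ℝ) := Real.sqrt_pos.2 hnpos
    have hsn2 : √(n : ℝ) * √(n : ℝ) = n := Real.mul_self_sqrt hnpos.le
    have hsn1 : 1 ≤ √(n : ℝ) := Real.one_le_sqrt.2 (by linarith)
    have h1 : Real.exp (-c) ≤ 1 / (n : ℝ) ^ 2 := by
      calc Real.exp (-c) ≤ Real.exp (-(2 * Real.log n)) := Real.exp_le_exp.2 (by linarith)
        _ = 1 / (n : ℝ) ^ 2 := by
          rw [Real.exp_neg, two_mul, Real.exp_add, Real.exp_log hnpos, sq, one_div]
    have h2 : 1 / √(n : ℝ) ≤ γ := (div_le_iff₀ hsn).2 hγ1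
    have h3 : 1 / (n : ℝ) ≤ √α := by
      refine Real.le_sqrt_of_sq_le (le_trans ?_ hα0)
      have : (1 / √(n : ℝ)) ^ 2 ≤ ε ^ 2 := by gcongr
      rw [div_pow, one_pow, Real.sq_sqrt hnpos.le] at this
      calc (1 / (n : ℝ)) ^ 2 = 1 / n / n := by field_simp
        _ ≤ _ := by gcongr
    calc Real.exp (-c) ≤ 1 / (n : ℝ) ^ 2 := h1
      _ ≤ 1 / √(n : ℝ) * (1 / n) := by
        rw [one_div_mul_one_div]
        refine one_div_le_one_div_of_le (by positivity) ?_
        nlinarith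
      _ ≤ γ * √α := mul_le_mul h2 h3 (by positivity) hγ.le
      _ ≤ _ := mul_le_mul_of_nonneg_right (by linarith) hsα0
  linarith

end PDBHP

theorem lemma3p3 :
    ∃ C : ℝ, 0 < C ∧ ∀ ε γ α : ℕ → ℝ,
      (fun n : ℕ => 1 / √(n : ℝ)) =o[atTop] ε →
      (∀ᶠ n in atTop, 0 < ε n ∧ ε n < 0.05) →
      (fun n : ℕ => Real.log n / √(n : ℝ)) =o[atTop] γ →
      (∀ᶠ n in atTop, 0 < γ n) →
      (∀ᶠ n : ℕ in atTop, ε n ^ 2 / n ≤ α n ∧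
        α n ≤ min ((10 : ℝ) ^ (-7 : ℤ) * γ n ^ (-2 : ℤ)) ((10 : ℝ) ^ (-4 : ℤ))) →
      ∀ᶠ n : ℕ in atTop, ∀ P : PDBHP.Protocol n,
        P.UsesAtMost (γ n * √(n : ℝ)) →
        P.advantage ⌊α n * n / ε n ^ 2⌋₊ (10 * ε n) ≤ C * ((γ n + α n) * √(α n)) := by
  refine ⟨54001, by norm_num, fun ε γ α hεo hε hγo hγ hα => ?_⟩
  -- The asymptotic hypotheses are needed only with constants `1` and `1/2`, giving `1/√n ≤ ε` and
  -- `2 log n ≤ γ√n`.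
  filter_upwards [hεo.def zero_lt_one, hε, hγo.def (by norm_num : (0 : ℝ) < 1 / 2), hγ, hα,
    eventually_ge_atTop 10] with n h1 h2 h3 h4 h5 hn P hP
  have hnR : (10 : ℝ) ≤ n := by exact_mod_cast hn
  have hsn : 0 < √(n : ℝ) := Real.sqrt_pos.2 (by linarith)
  have hlog : 1 / 2 ≤ Real.log n := by
    refine (Real.le_log_iff_exp_le (by linarith)).2 ?_
    have := Real.exp_one_lt_d9
    have h := Real.exp_le_exp.2 (by norm_num : (1 / 2 : ℝ) ≤ 1)
    linarith
  rw [Real.norm_of_nonneg (by positivity), Real.norm_of_nonneg h2.1.le, one_mul] at h1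
  rw [Real.norm_of_nonneg (div_nonneg (by linarith) hsn.le), Real.norm_of_nonneg h4.le,
    div_le_iff₀ hsn] at h3
  have hγn : 2 * Real.log n ≤ γ n * √(n : ℝ) := by linarith
  have hαγ := h5.2.trans (min_le_left _ _)
  refine P.advantage_le_of_params hn h2.1 h2.2 h1 h4 hγn (by linarith) h5.1 ?_ ?_ hP
  · have h := mul_le_mul_of_nonneg_right hαγ (sq_nonneg (γ n))
    refine h.trans (le_of_eq ?_)
    have : γ n ≠ 0 := h4.ne'
    rw [zpow_neg, zpow_neg]
    norm_cast
    field_simp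
  · refine (h5.2.trans (min_le_right _ _)).trans (le_of_eq ?_)
    norm_num
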